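/- Let $A, D, E, F$ be finite-dimensional quantum systems (complex Hilbert spaces), let $\rho_{AD}$ be a density operator on $A\otimes D$ and $\sigma_{AE}$ a density operator on $A\otimes E$ with $\sigma_A=\mathrm{tr}_E[\sigma_{AE}]>0$, and let $\sigma_{AEF}$ be a purification of $\sigma_{AE}$, i.e. $\sigma_{AEF}=|\psi\rangle\langle\psi|$ for some vector $\psi\in A\otimes E\otimes F$ and $\mathrm{tr}_F[\sigma_{AEF}]=\sigma_{AE}$; write $\sigma_{AF}=\mathrm{tr}_E[\sigma_{AEF}]$. Here $\log$ is the natural logarithm. For a density operator $\rho$ and a positive semidefinite $\sigma$ let $D(\rho\|\sigma)=\mathrm{tr}[\rho(\log\rho-\log\sigma)]$ if the support of $\rho$ is contained in that of $\sigma$, and $D(\rho\|\sigma)=+\infty$ otherwise. Let $$D^{\mathbb M}(\rho\|\sigma)=\sup_{M}\ \sum_{x}\mathrm{tr}[M(x)\rho]\,\log\frac{\mathrm{tr}[M(x)\rho]}{\mathrm{tr}[M(x)\sigma]},$$ where the supremum is over all positive operator valued measures $M$ with finitely many outcomes (terms with $\mathrm{tr}[M(x)\rho]=0$ are $0$, and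 the sum is $+\infty$ if $\mathrm{tr}[M(x)\sigma]=0<\mathrm{tr}[M(x)\rho]$ for some $x$). Let $$D^{\mathrm{rec}}(\rho_{AD}\|\sigma_{AE})=\inf_{\Gamma_{E\to D}}D\big(\rho_{AD}\,\big\|\,(\mathcal I_A\otimes\Gamma_{E\to D})(\sigma_{AE})\big),$$ where the infimum is over all completely positive trace-preserving maps $\Gamma_{E\to D}$. Then $D^{\mathrm{rec}}(\rho_{AD}\|\sigma_{AE})$ is the optimal value (supremum) of the program $$\begin{aligned}\text{maximize}\quad & \mathrm{tr}[\rho_{AD}\log\rho_{AD}]-D^{\mathbb M}(\rho_{AD}\|R_{AD})\\ \text{subject to}\quad & S_{AF}>0,\quad R_{AD}>0,\\ & 1_D\otimes S_{AF}\ge R_{AD}\otimes 1_F,\\ & \mathrm{tr}[S_{AF}\sigma_{AF}]=1,\end{aligned}$$ where $R_{AD}$ need not be normalized. -/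

import Mathlib

open scoped Kronecker Matrix ComplexOrder

noncomputable section

namespace RelEntRecovery

/-- Density operators: positive semidefinite with unit trace. -/
def IsDensity {K : Type*} [Fintype K] (ρ : Matrix K K ℂ) : Prop :=
  ρ.PosSemidef ∧ ρ.trace = 1

/-- Partial trace over the second tensor factor. -/
def traceRight {K L : Type*} [Fintype L] (X : Matrix (K × L) (K × L) ℂ) : Matrix K K ℂ :=
  Matrix.of fun i j => ∑ l, X (i, l) (j, l)

/-- `τ` (on `K ⊗ L`) is a purification of `σ` (on `K`): a rank-one operator `|ψ⟩⟨ψ|` whose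
marginal on `K` is `σ`. -/
def IsPurification {K L : Type*} [Fintype L] (τ : Matrix (K × L) (K × L) ℂ)
    (σ : Matrix K K ℂ) : Prop :=
  (∃ ψ : K × L → ℂ, τ = Matrix.vecMulVec ψ (star ψ)) ∧ traceRight τ = σ

/-- The marginal on `AF` of an operator on `AEF`, that is, the partial trace over the middle
factor `E`. -/
def marginalAF {A E F : Type*} [Fintype E]
    (τ : Matrix ((A × E) × F) ((A × E) × F) ℂ) : Matrix (A × F) (A × F) ℂ :=
  Matrix.of fun x y => ∑ e, τ ((x.1, e), x.2) ((y.1, e), y.2)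

/-- The operator `1_D ⊗ S_AF` on `ADF`; the kronecker product lists the factors as `D, A, F`, and
`submatrix` puts them in the order `A, D, F`. -/
def oneTensorAF {A D F : Type*} [DecidableEq D] (S : Matrix (A × F) (A × F) ℂ) :
    Matrix ((A × D) × F) ((A × D) × F) ℂ :=
  ((1 : Matrix D D ℂ) ⊗ₖ S).submatrix
    (fun x => (x.1.2, (x.1.1, x.2))) (fun x => (x.1.2, (x.1.1, x.2)))

/-- The map `id_K ⊗ Γ`, which applies `Γ` to each of the `E`-blocks of an operator on
`K ⊗ E`. -/
def idTensor {K E D : Type*} (Γ : Matrix E E ℂ →ₗ[ℂ] Matrix D D ℂ)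
    (X : Matrix (K × E) (K × E) ℂ) : Matrix (K × D) (K × D) ℂ :=
  Matrix.of fun x y => Γ (Matrix.of fun e e' => X (x.1, e) (y.1, e')) x.2 y.2

/-- Quantum channels: completely positive trace-preserving linear maps. -/
structure IsChannel {E D : Type*} [Fintype E] [Fintype D]
    (Γ : Matrix E E ℂ →ₗ[ℂ] Matrix D D ℂ) : Prop where
  completelyPositive : ∀ (n : ℕ) (X : Matrix (Fin n × E) (Fin n × E) ℂ),
    X.PosSemidef → (idTensor Γ X).PosSemidef
  tracePreserving : ∀ X : Matrix E E ℂ, (Γ X).trace = X.trace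

/-- The matrix logarithm of a Hermitian matrix, through the functional calculus (natural
logarithm). As `Real.log 0 = 0`, it is the logarithm on the support and zero on the kernel. -/
def matLog {K : Type*} [Fintype K] [DecidableEq K] (ρ : Matrix K K ℂ) : Matrix K K ℂ :=
  cfc Real.log ρ

open Classical in
/-- Umegaki's relative entropy `D(ρ‖σ) = tr[ρ (log ρ - log σ)]` if the support of `ρ` is contained
in that of `σ` (for Hermitian operators: `ker σ ⊆ ker ρ`), and `+∞` otherwise. -/
def relEntropy {K : Type*} [Fintype K] [DecidableEq K] (ρ σ : Matrix K K ℂ) : EReal :=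
  if ∀ v : K → ℂ, σ *ᵥ v = 0 → ρ *ᵥ v = 0 then
    (((ρ * (matLog ρ - matLog σ)).trace.re : ℝ) : EReal)
  else ⊤

open Classical in
/-- The Kullback-Leibler divergence `∑ x, P x log (P x / Q x)` of nonnegative weights on a finite
set, `+∞` unless `P ≪ Q`; `Q` need not be normalized, and there is no correction term
`∑ Q - ∑ P`. Terms with `P x = 0` vanish. -/
def klDivergence {X : Type*} [Fintype X] (P Q : X → ℝ) : EReal :=
  if ∀ x, Q x = 0 → P x = 0 then ((∑ x, P x * Real.log (P x / Q x) : ℝ) : EReal) else ⊤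

/-- Positive operator valued measures with outcomes in a finite set. -/
def IsPOVM {X K : Type*} [Fintype X] [Fintype K] [DecidableEq K]
    (M : X → Matrix K K ℂ) : Prop :=
  (∀ x, (M x).PosSemidef) ∧ ∑ x, M x = 1

/-- The outcome weights `x ↦ tr[M x ρ]`. -/
def outcome {X K : Type*} [Fintype K] (M : X → Matrix K K ℂ) (ρ : Matrix K K ℂ) : X → ℝ :=
  fun x => (M x * ρ).trace.re

/-- The measured relative entropy: the supremum over all POVMs with finitely many outcomes of the
Kullback-Leibler divergence of the outcome weights. -/
def measuredRelEntropy {K : Type*} [Fintype K] [DecidableEq K] (ρ σ : Matrix K K ℂ) : EReal :=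
  ⨆ (n : ℕ) (M : Fin n → Matrix K K ℂ) (_ : IsPOVM M),
    klDivergence (outcome M ρ) (outcome M σ)

/-- The relative entropy of recovery: the infimum over all channels `Γ` from `E` to `D` of
`D(ρ_AD ‖ (id_A ⊗ Γ)(σ_AE))`. -/
def relEntropyOfRecovery {A D E : Type*} [Fintype A] [DecidableEq A] [Fintype D] [DecidableEq D]
    [Fintype E] (ρ : Matrix (A × D) (A × D) ℂ) (σ : Matrix (A × E) (A × E) ℂ) : EReal :=
  ⨅ (Γ : Matrix E E ℂ →ₗ[ℂ] Matrix D D ℂ) (_ : IsChannel Γ), relEntropy ρ (idTensor Γ σ)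

end RelEntRecovery

end

/-! Up to the constant `tr[ρ log ρ]`, recovery maximizes the concave function `ω ↦ tr[ρ log ω]` over
the convex set of states `Γ(σ)`. The program is the dual problem, in which `R` is a supergradient
and `S` certifies a bound on `tr[R Γ(σ)]` over all channels.

Weak duality: the purification turns `Γ(σ)` into an operator on `ADF` whose `AF`-marginal is `σ_AF`,
so the operator constraint gives `tr[R Γ(σ)] ≤ tr[S σ_AF] = 1` (`re_trace_mul_idTensor_le`).
Measuring in the eigenbasis of `Γ(σ)` and using `log x ≤ x - 1` then gives `D^𝕄(ρ‖R) ≥ tr[ρ log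
Γ(σ)]` (`logTrace_le_measuredRelEntropy`).

Strong duality: let `m` bound `tr[ρ log ω]` over the positive definite recovered states. Separating
the hypograph from the recovered states at height `m` yields `R₀ ≥ 0` and `c` with `tr[ρ log ω] ≤ c
+ tr[R₀ ω]` for all `ω > 0`, and `c + tr[R₀ Γ(σ)] ≤ m` for all `Γ` (`exists_supergradient`). By
operator Jensen, the first bound controls every measurement (`measuredRelEntropy_le`). Every `T ≥ 0`
on `ADF` with `AF`-marginal `σ_AF` has its `AD`-marginal dominated by some `Γ(σ)`
(`exists_isChannel_of_marginalAF_eq`), so the second bound passes to such `T`, and semidefinite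
duality produces `S` (`exists_dual_feasible`). Dividing `R` and `S` by `tr[S σ_AF]` makes them
feasible. -/

namespace RelEntRecovery
open Matrix Filter Topology
noncomputable section

/-! ### Traces of products and outcome weights -/

section Trace
variable {K L : Type*} [Fintype K] [Fintype L]

theorem trace_mul_nonneg {X Y : Matrix K K ℂ} (hX : X.PosSemidef) (hY : Y.PosSemidef) :
    0 ≤ (X * Y).trace := by
  classical
  obtain ⟨m, v, rfl⟩ := Matrix.posSemidef_iff_eq_sum_vecMulVec.mp hY
  rw [Finset.mul_sum, trace_sum]
  refine Finset.sum_nonneg fun i _ => ?_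
  rw [mul_vecMulVec, trace_vecMulVec, dotProduct_comm]
  exact hX.dotProduct_mulVec_nonneg _

theorem re_trace_mul_nonneg {X Y : Matrix K K ℂ} (hX : X.PosSemidef) (hY : Y.PosSemidef) :
    0 ≤ (X * Y).trace.re :=
  (Complex.le_def.mp (trace_mul_nonneg hX hY)).1

theorem trace_mul_vecMulVec (X : Matrix K K ℂ) (v : K → ℂ) :
    (X * vecMulVec v (star v)).trace = star v ⬝ᵥ (X *ᵥ v) := by
  rw [mul_vecMulVec, trace_vecMulVec, dotProduct_comm]

theorem im_quadratic_form {X : Matrix K K ℂ} (hX : X.IsHermitian) (v : K → ℂ) :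
    (star v ⬝ᵥ (X *ᵥ v)).im = 0 := hX.im_star_dotProduct_mulVec_self v

theorem posSemidef_of_re_trace {X : Matrix K K ℂ} (hX : X.IsHermitian)
    (h : ∀ v : K → ℂ, 0 ≤ (X * vecMulVec v (star v)).trace.re) : X.PosSemidef := by
  refine .of_dotProduct_mulVec_nonneg hX fun v => ?_
  rw [Complex.le_def]
  refine ⟨by simpa [trace_mul_vecMulVec] using h v, ?_⟩
  simpa using (im_quadratic_form hX v).symm

theorem re_trace_real_smul (a : ℝ) (X : Matrix K K ℂ) : ((a : ℂ) • X).trace.re = a * X.trace.re := by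
  simp

theorem re_trace_mul_sum_smul {X : Type*} [Fintype X] (ρ : Matrix K K ℂ) (M : X → Matrix K K ℂ)
    (a : X → ℝ) :
    (ρ * ∑ x, (a x : ℂ) • M x).trace.re = ∑ x, a x * outcome M ρ x := by
  simp only [Finset.mul_sum, trace_sum, Complex.re_sum, outcome]
  refine Finset.sum_congr rfl fun x _ => ?_
  rw [mul_smul_comm, re_trace_real_smul, trace_mul_comm]

theorem outcome_nonneg {X : Type*} [Fintype X] [DecidableEq K] {M : X → Matrix K K ℂ}
    (hM : IsPOVM M) {ρ : Matrix K K ℂ} (hρ : ρ.PosSemidef) (x : X) : 0 ≤ outcome M ρ x :=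
  re_trace_mul_nonneg (hM.1 x) hρ

theorem sum_outcome {X : Type*} [Fintype X] [DecidableEq K] {M : X → Matrix K K ℂ}
    (hM : IsPOVM M) (ρ : Matrix K K ℂ) : ∑ x, outcome M ρ x = ρ.trace.re := by
  simp only [outcome, ← Complex.re_sum, ← trace_sum, ← Finset.sum_mul, hM.2, one_mul]

end Trace

/-! ### Spectral resolutions as measurements -/

section Spectral
variable {K : Type*} [Fintype K] [DecidableEq K]

/-- `l` and `P` are the eigenvalues of `H` with their rank-one eigenprojections. -/
structure IsResolution (H : Matrix K K ℂ) (l : K → ℝ) (P : K → Matrix K K ℂ) : Prop where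
  povm : IsPOVM P
  mul_self : ∀ i, P i * P i = P i
  mul_of_ne : ∀ i j, i ≠ j → P i * P j = 0
  trace_eq : ∀ i, (P i).trace = 1
  cfc_eq : ∀ g : ℝ → ℝ, cfc g H = ∑ i, (g (l i) : ℂ) • P i
  eq_sum : H = ∑ i, (l i : ℂ) • P i

theorem exists_isResolution {H : Matrix K K ℂ} (hH : H.IsHermitian) :
    ∃ l P, IsResolution H l P := by
  set U := hH.eigenvectorUnitary
  have hU : (U : Matrix K K ℂ)ᴴ * (U : Matrix K K ℂ) = 1 := Unitary.coe_star_mul_self U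
  have hU' : (U : Matrix K K ℂ) * (U : Matrix K K ℂ)ᴴ = 1 := Unitary.coe_mul_star_self U
  have key : ∀ d : K → ℂ, (U : Matrix K K ℂ) * diagonal d * (U : Matrix K K ℂ)ᴴ
      = ∑ i, d i • ((U : Matrix K K ℂ) * diagonal (Pi.single i 1) * (U : Matrix K K ℂ)ᴴ) := by
    intro d
    have : diagonal d = ∑ i, d i • diagonal (Pi.single i (1:ℂ)) := by
      ext a b
      by_cases hab : a = b
      · subst hab
        simp [Matrix.sum_apply, Pi.single_apply]
      · simp [Matrix.sum_apply, hab]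
    conv_lhs => rw [this]
    simp [Finset.mul_sum, Finset.sum_mul]
  have hmul : ∀ A B : Matrix K K ℂ, ((U : Matrix K K ℂ) * A * (U : Matrix K K ℂ)ᴴ) *
      ((U : Matrix K K ℂ) * B * (U : Matrix K K ℂ)ᴴ) = U * (A * B) * (U : Matrix K K ℂ)ᴴ := by
    intro A B
    calc _ = (U : Matrix K K ℂ) * A * ((U : Matrix K K ℂ)ᴴ * (U : Matrix K K ℂ)) * B
          * (U : Matrix K K ℂ)ᴴ := by noncomm_ring
      _ = _ := by rw [hU]; noncomm_ring
  refine ⟨hH.eigenvalues,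
    fun i => (U : Matrix K K ℂ) * diagonal (Pi.single i 1) * (U : Matrix K K ℂ)ᴴ,
    ⟨fun i => ?_, ?_⟩, fun i => ?_, fun i j hij => ?_, fun i => ?_, fun g => ?_, ?_⟩
  · refine PosSemidef.mul_mul_conjTranspose_same (PosSemidef.diagonal ?_) _
    intro j
    by_cases h : j = i
    · subst h; simp
    · simp [h]
  · have := key (fun _ => 1)
    simp only [one_smul] at this
    rw [← this]
    simp [hU']
  · rw [hmul, diagonal_mul_diagonal]
    congr 3
    ext j
    by_cases h : j = i
    · subst h; simp
    · simp [h]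
  · rw [hmul, diagonal_mul_diagonal]
    have : (fun k => (Pi.single i (1:ℂ) : K → ℂ) k * (Pi.single j (1:ℂ) : K → ℂ) k) = 0 := by
      ext k
      by_cases h : k = i
      · subst h; simp [hij]
      · simp [h]
    rw [this]; simp
  · rw [trace_mul_cycle, hU, one_mul, trace_diagonal]
    simp
  · rw [hH.cfc_eq, IsHermitian.cfc, Unitary.conjStarAlgAut_apply]
    exact key _
  · conv_lhs => rw [hH.spectral_theorem, Unitary.conjStarAlgAut_apply]
    exact key _

namespace IsResolution
variable {H : Matrix K K ℂ} {l : K → ℝ} {P : K → Matrix K K ℂ} (h : IsResolution H l P)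
include h

theorem sum_smul_mul_sum_smul (a b : K → ℂ) :
    (∑ i, a i • P i) * (∑ i, b i • P i) = ∑ i, (a i * b i) • P i := by
  rw [Finset.sum_mul]
  refine Finset.sum_congr rfl fun i _ => ?_
  rw [Finset.mul_sum, Finset.sum_eq_single i]
  · rw [smul_mul_smul_comm, h.mul_self]
  · intro j _ hj
    rw [smul_mul_smul_comm, h.mul_of_ne i j hj.symm, smul_zero]
  · simp

theorem mul_proj (i : K) : H * P i = (l i : ℂ) • P i := by
  rw [h.eq_sum, Finset.sum_mul, Finset.sum_eq_single i]
  · rw [smul_mul_assoc, h.mul_self]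
  · intro j _ hj
    rw [smul_mul_assoc, h.mul_of_ne j i hj, smul_zero]
  · simp

theorem outcome_self (i : K) : outcome P H i = l i := by
  rw [outcome, trace_mul_comm, h.mul_proj, re_trace_real_smul, h.trace_eq]
  simp

theorem eigenvalue_nonneg (hH : H.PosSemidef) (i : K) : 0 ≤ l i := by
  rw [← h.outcome_self i]
  exact outcome_nonneg h.povm hH i

theorem le_eigenvalue {a : ℝ} (hH : (H - (a : ℂ) • (1 : Matrix K K ℂ)).PosSemidef) (i : K) :
    a ≤ l i := by
  have h1 := outcome_nonneg h.povm hH i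
  have h2 := h.outcome_self i
  simp only [outcome, mul_sub, trace_sub, Complex.sub_re, mul_smul_comm, mul_one,
    re_trace_real_smul, h.trace_eq] at h1 h2
  simp at h1
  linarith

theorem re_trace_mul_cfc (ρ : Matrix K K ℂ) (g : ℝ → ℝ) :
    (ρ * cfc g H).trace.re = ∑ i, g (l i) * outcome P ρ i := by
  rw [h.cfc_eq, re_trace_mul_sum_smul]

end IsResolution

omit [DecidableEq K] in
theorem re_trace_mul_pos {N R : Matrix K K ℂ} (hN : N.PosSemidef) (hN0 : N ≠ 0) (hR : R.PosDef) :
    0 < (N * R).trace.re := by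
  obtain ⟨m, v, hv⟩ := Matrix.posSemidef_iff_eq_sum_vecMulVec.mp hN
  have hne : ∃ i, v i ≠ 0 := by
    by_contra! hall
    exact hN0 (by rw [hv]; simp [hall])
  obtain ⟨i, hi⟩ := hne
  rw [trace_mul_comm, hv, Finset.mul_sum, trace_sum, Complex.re_sum]
  refine Finset.sum_pos' (fun j _ => ?_) ⟨i, Finset.mem_univ _, ?_⟩
  · rw [trace_mul_vecMulVec]
    exact hR.posSemidef.re_dotProduct_nonneg _
  · rw [trace_mul_vecMulVec]
    exact hR.re_dotProduct_pos hi

theorem outcome_pos {X : Type*} [Fintype X] {M : X → Matrix K K ℂ} (hM : IsPOVM M)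
    {R : Matrix K K ℂ} (hR : R.PosDef) {x : X} (hx : M x ≠ 0) : 0 < outcome M R x :=
  re_trace_mul_pos (hM.1 x) hx hR

theorem IsResolution.eigenvalue_pos {H : Matrix K K ℂ} {l : K → ℝ} {P : K → Matrix K K ℂ}
    (h : IsResolution H l P) (hH : H.PosDef) (i : K) : 0 < l i := by
  rw [← h.outcome_self i]
  refine outcome_pos h.povm hH fun h0 => ?_
  simpa [h0] using h.trace_eq i

end Spectral

/-! ### Operator Jensen inequality for the logarithm -/

section Jensen
variable {K X : Type*} [Fintype K] [DecidableEq K] [Fintype X]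

/-- `(∑ b x • M x)⁻¹ ≤ ∑ (b x)⁻¹ • M x` for a POVM `M`, as quadratic forms at `v = (∑ b x • M x) u`. -/
theorem inverse_quadratic_form_le {M : X → Matrix K K ℂ} (hM : IsPOVM M) {b : X → ℝ}
    (hb : ∀ x, 0 < b x) {u v : K → ℂ} (huv : (∑ x, (b x : ℂ) • M x) *ᵥ u = v) :
    (star u ⬝ᵥ v).re ≤ ∑ x, (b x)⁻¹ * (star v ⬝ᵥ (M x *ᵥ v)).re := by
  -- Expand `⟨v - b u, M (v - b u)⟩ ≥ 0` and divide by `b`. Summed over `x`, both the cross terms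
  -- and the last terms reduce to `⟨u, v⟩`.
  have key : ∀ x, 0 ≤ (b x)⁻¹ * (star v ⬝ᵥ (M x *ᵥ v)).re - 2 * (star u ⬝ᵥ (M x *ᵥ v)).re
      + b x * (star u ⬝ᵥ (M x *ᵥ u)).re := by
    intro x
    have h0 := (hM.1 x).re_dotProduct_nonneg (v - (b x : ℂ) • u)
    have hsymm : (star v ⬝ᵥ (M x *ᵥ u)).re = (star u ⬝ᵥ (M x *ᵥ v)).re := by
      have : star (star v ⬝ᵥ (M x *ᵥ u)) = star u ⬝ᵥ (M x *ᵥ v) := by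
        rw [star_dotProduct, star_mulVec, (hM.1 x).1.eq, ← dotProduct_mulVec, star_star]
      rw [← this]; rfl
    simp only [star_sub, star_smul, mulVec_sub, mulVec_smul, sub_dotProduct, dotProduct_sub,
      smul_dotProduct, dotProduct_smul, smul_eq_mul, RCLike.re_to_complex, Complex.sub_re,
      Complex.star_def, Complex.conj_ofReal, Complex.re_ofReal_mul, hsymm] at h0
    have := mul_nonneg (inv_nonneg.2 (hb x).le) h0
    have hbx := (hb x).ne'
    have e : (b x)⁻¹ * ((star v ⬝ᵥ M x *ᵥ v).re - b x * (star u ⬝ᵥ M x *ᵥ v).re -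
       b x * ((star u ⬝ᵥ M x *ᵥ v).re - b x * (star u ⬝ᵥ M x *ᵥ u).re)) =
       (b x)⁻¹ * (star v ⬝ᵥ (M x *ᵥ v)).re - 2 * (star u ⬝ᵥ (M x *ᵥ v)).re
      + b x * (star u ⬝ᵥ (M x *ᵥ u)).re := by
      field_simp
      ring
    rw [← e]
    convert this using 2
  have hs := Finset.sum_nonneg fun x (_ : x ∈ Finset.univ) => key x
  rw [Finset.sum_add_distrib, Finset.sum_sub_distrib, ← Finset.mul_sum] at hs
  have h1 : ∑ x, (star u ⬝ᵥ (M x *ᵥ v)).re = (star u ⬝ᵥ v).re := by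
    rw [← Complex.re_sum, ← dotProduct_sum, ← sum_mulVec, hM.2, one_mulVec]
  have h2 : ∑ x, b x * (star u ⬝ᵥ (M x *ᵥ u)).re = (star u ⬝ᵥ v).re := by
    conv_rhs => rw [← huv, sum_mulVec, dotProduct_sum, Complex.re_sum]
    refine Finset.sum_congr rfl fun x _ => ?_
    rw [smul_mulVec, dotProduct_smul, smul_eq_mul, Complex.re_ofReal_mul]
  rw [h1, h2] at hs
  linarith

theorem tendsto_log_add_sub_log (a : ℝ) :
    Tendsto (fun s : ℝ => Real.log (a + s) - Real.log s) atTop (𝓝 0) := by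
  have h1 : Tendsto (fun s : ℝ => Real.log (a / s + 1)) atTop (𝓝 0) := by
    have : Tendsto (fun s : ℝ => a / s + 1) atTop (𝓝 (0 + 1)) :=
      (tendsto_const_nhds.div_atTop tendsto_id).add tendsto_const_nhds
    rw [zero_add] at this
    simpa [Function.comp_def] using (Real.continuousAt_log one_ne_zero).tendsto.comp this
  refine h1.congr' ?_
  filter_upwards [eventually_gt_atTop 0, eventually_gt_atTop (-a)] with s hs hs'
  rw [← Real.log_div (by linarith) hs.ne', add_div, div_self hs.ne']

/-- Two finite measures on `(0, ∞)` of equal mass whose Stieltjes transforms are ordered have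
logarithmic moments in the same order. -/
theorem sum_log_le_sum_log_of_stieltjes {ι κ : Type*} [Fintype ι] [Fintype κ]
    {l w : ι → ℝ} {a m : κ → ℝ} (hl : ∀ i, 0 < l i) (ha : ∀ x, 0 < a x)
    (hmass : ∑ i, w i = ∑ x, m x)
    (hle : ∀ s, 0 ≤ s → ∑ i, w i / (l i + s) ≤ ∑ x, m x / (a x + s)) :
    ∑ x, m x * Real.log (a x) ≤ ∑ i, w i * Real.log (l i) := by
  -- The derivative of `g` is the difference of the Stieltjes transforms, hence nonpositive. Equal
  -- masses cancel the `log s` growth, so `g` tends to `0` at infinity and `g 0 ≥ 0`. This plays the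
  -- role of the integral representation of `log`.
  set g : ℝ → ℝ := fun s => ∑ i, w i * Real.log (l i + s) - ∑ x, m x * Real.log (a x + s)
  have hd : ∀ s, 0 ≤ s → HasDerivAt g (∑ i, w i / (l i + s) - ∑ x, m x / (a x + s)) s := by
    intro s hs
    refine HasDerivAt.sub (HasDerivAt.fun_sum fun i _ => ?_) (HasDerivAt.fun_sum fun x _ => ?_)
    · have := ((hasDerivAt_id s).const_add (l i)).log (by have := hl i; simp; linarith)
      simpa [div_eq_mul_inv] using this.const_mul (w i)
    · have := ((hasDerivAt_id s).const_add (a x)).log (by have := ha x; simp; linarith)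
      simpa [div_eq_mul_inv] using this.const_mul (m x)
  have hanti : AntitoneOn g (Set.Ici 0) := by
    refine antitoneOn_of_deriv_nonpos (convex_Ici 0)
      (fun s hs => (hd s hs).continuousAt.continuousWithinAt)
      (fun s hs => (hd s (interior_subset hs)).differentiableAt.differentiableWithinAt)
      fun s hs => ?_
    have hs' : 0 ≤ s := interior_subset hs
    rw [(hd s hs').deriv]
    linarith [hle s hs']
  have hlim : Tendsto g atTop (𝓝 0) := by
    have h1 : Tendsto (fun s : ℝ => ∑ i, w i * (Real.log (l i + s) - Real.log s)
        - ∑ x, m x * (Real.log (a x + s) - Real.log s)) atTop (𝓝 0) := by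
      have := (tendsto_finsetSum Finset.univ fun i _ =>
        (tendsto_log_add_sub_log (l i)).const_mul (w i)).sub
        (tendsto_finsetSum Finset.univ fun x _ =>
        (tendsto_log_add_sub_log (a x)).const_mul (m x))
      simpa using this
    refine h1.congr fun s => ?_
    simp only [mul_sub, Finset.sum_sub_distrib, ← Finset.sum_mul, hmass, g]
    ring
  have h0 : 0 ≤ g 0 := le_of_tendsto hlim <| by
    filter_upwards [eventually_ge_atTop 0] with s hs
    exact hanti Set.self_mem_Ici hs hs
  simp only [g, add_zero] at h0
  linarith

/-- Jensen's operator inequality for the logarithm and a POVM, as quadratic forms. -/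
theorem sum_log_mul_quadratic_form_le {M : X → Matrix K K ℂ} (hM : IsPOVM M) {a : X → ℝ}
    (ha : ∀ x, 0 < a x) (v : K → ℂ) {l : K → ℝ} {P : K → Matrix K K ℂ}
    (h : IsResolution (∑ x, (a x : ℂ) • M x) l P) (hl : ∀ i, 0 < l i) :
    ∑ x, (star v ⬝ᵥ (M x *ᵥ v)).re * Real.log (a x)
      ≤ ∑ i, (star v ⬝ᵥ (P i *ᵥ v)).re * Real.log (l i) := by
  refine sum_log_le_sum_log_of_stieltjes hl ha ?_ fun s hs => ?_
  · rw [← Complex.re_sum, ← dotProduct_sum, ← sum_mulVec, h.povm.2, ← Complex.re_sum,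
      ← dotProduct_sum, ← sum_mulVec, hM.2]
  -- With `H = ∑ a x • M x`, this is `u = (H + s)⁻¹ v`. Since `∑ M x = 1`, shifting every `a x` by
  -- `s` shifts `H` by `s`.
  set u : K → ℂ := (∑ i, (((l i + s)⁻¹ : ℝ) : ℂ) • P i) *ᵥ v
  have hshift : ∑ x, ((a x + s : ℝ) : ℂ) • M x = ∑ i, ((l i + s : ℝ) : ℂ) • P i := by
    simp only [Complex.ofReal_add, add_smul, Finset.sum_add_distrib, ← Finset.smul_sum, hM.2,
      h.povm.2, ← h.eq_sum]
  have huv : (∑ x, ((a x + s : ℝ) : ℂ) • M x) *ᵥ u = v := by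
    rw [hshift, mulVec_mulVec, h.sum_smul_mul_sum_smul]
    have : ∀ i, ((l i + s : ℝ) : ℂ) * (((l i + s)⁻¹ : ℝ) : ℂ) = 1 := fun i => by
      rw [← Complex.ofReal_mul, mul_inv_cancel₀ (by linarith [hl i]), Complex.ofReal_one]
    simp only [this, one_smul, h.povm.2, one_mulVec]
  have hq := inverse_quadratic_form_le hM (b := fun x => a x + s)
    (fun x => by have := ha x; positivity) huv
  have hu : (star u ⬝ᵥ v).re = ∑ i, (star v ⬝ᵥ (P i *ᵥ v)).re / (l i + s) := by
    have : star u = star v ᵥ* (∑ i, (((l i + s)⁻¹ : ℝ) : ℂ) • P i) := by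
      rw [star_mulVec, conjTranspose_sum]
      simp only [conjTranspose_smul, (h.povm.1 _).1.eq, Complex.star_def, Complex.conj_ofReal]
    rw [this, ← dotProduct_mulVec, sum_mulVec, dotProduct_sum, Complex.re_sum]
    refine Finset.sum_congr rfl fun i _ => ?_
    rw [smul_mulVec, dotProduct_smul, smul_eq_mul, Complex.re_ofReal_mul, div_eq_inv_mul]
  rw [hu] at hq
  refine hq.trans (le_of_eq (Finset.sum_congr rfl fun x _ => ?_))
  rw [div_eq_inv_mul]

/-- Jensen's operator inequality for the logarithm and a POVM, tested against `ρ ≥ 0`. -/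
theorem sum_log_mul_outcome_le {M : X → Matrix K K ℂ} (hM : IsPOVM M) {a : X → ℝ}
    (ha : ∀ x, 0 < a x) (hpos : (∑ x, (a x : ℂ) • M x).PosDef) {ρ : Matrix K K ℂ}
    (hρ : ρ.PosSemidef) :
    ∑ x, outcome M ρ x * Real.log (a x) ≤ (ρ * matLog (∑ x, (a x : ℂ) • M x)).trace.re := by
  obtain ⟨l, P, h⟩ := exists_isResolution hpos.isHermitian
  obtain ⟨n, v, hv⟩ := Matrix.posSemidef_iff_eq_sum_vecMulVec.mp hρ
  have hout : ∀ N : Matrix K K ℂ, (N * ρ).trace.re = ∑ j, (star (v j) ⬝ᵥ (N *ᵥ v j)).re := by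
    intro N
    rw [hv, Finset.mul_sum, trace_sum, Complex.re_sum]
    simp only [trace_mul_vecMulVec]
  rw [matLog, h.re_trace_mul_cfc]
  simp only [outcome, hout, Finset.sum_mul, Finset.mul_sum]
  rw [Finset.sum_comm, Finset.sum_comm (s := Finset.univ (α := K))]
  refine Finset.sum_le_sum fun j _ => ?_
  refine (sum_log_mul_quadratic_form_le hM ha (v j) h (h.eigenvalue_pos hpos)).trans
    (le_of_eq (Finset.sum_congr rfl fun i _ => mul_comm _ _))

end Jensen

/-! ### Concavity of `ω ↦ tr[ρ log ω]` and Hermitian parts -/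

section LogTrace
variable {K : Type*} [Fintype K] [DecidableEq K]

theorem posDef_sum_smul {X : Type*} [Fintype X] {M : X → Matrix K K ℂ} (hM : IsPOVM M)
    {a : X → ℝ} (ha : ∀ x, 0 < a x) : (∑ x, (a x : ℂ) • M x).PosDef := by
  have hpsd : (∑ x, (a x : ℂ) • M x).PosSemidef :=
    posSemidef_sum _ fun x _ => (hM.1 x).smul (by exact_mod_cast (ha x).le)
  refine .of_dotProduct_mulVec_pos hpsd.1 fun v hv => ?_
  rw [Complex.lt_def]
  refine ⟨?_, by simpa using (im_quadratic_form hpsd.1 v).symm⟩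
  have h1 : 0 < ∑ x, (star v ⬝ᵥ (M x *ᵥ v)).re := by
    rw [← Complex.re_sum, ← dotProduct_sum, ← sum_mulVec, hM.2]
    exact PosDef.one.re_dotProduct_pos hv
  obtain ⟨x, -, hx⟩ := Finset.exists_lt_of_sum_lt (s := Finset.univ) (f := fun _ : X => (0 : ℝ))
    (by simpa using h1)
  rw [sum_mulVec, dotProduct_sum, Complex.re_sum]
  simp only [smul_mulVec, dotProduct_smul, smul_eq_mul, Complex.re_ofReal_mul, Complex.zero_re]
  exact Finset.sum_pos' (fun y _ => mul_nonneg (ha y).le ((hM.1 y).re_dotProduct_nonneg v))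
    ⟨x, Finset.mem_univ _, mul_pos (ha x) hx⟩

/-- The function `ω ↦ tr[ρ log ω]`. -/
def logTrace (ρ ω : Matrix K K ℂ) : ℝ := (ρ * matLog ω).trace.re

/-- The two eigenprojection families, weighted by `s` and `t`, form a single POVM. Assigning it the
eigenvalues of `ω₁` and `ω₂` makes operator Jensen exactly this concavity. -/
theorem logTrace_concave {ρ : Matrix K K ℂ} (hρ : ρ.PosSemidef) {ω₁ ω₂ : Matrix K K ℂ}
    (h₁ : ω₁.PosDef) (h₂ : ω₂.PosDef) {s t : ℝ} (hs : 0 ≤ s) (ht : 0 ≤ t) (hst : s + t = 1) :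
    s * logTrace ρ ω₁ + t * logTrace ρ ω₂ ≤ logTrace ρ ((s : ℂ) • ω₁ + (t : ℂ) • ω₂) := by
  obtain ⟨l, P, hP⟩ := exists_isResolution h₁.isHermitian
  obtain ⟨r, Q, hQ⟩ := exists_isResolution h₂.isHermitian
  set M : K ⊕ K → Matrix K K ℂ := Sum.elim (fun i => (s : ℂ) • P i) (fun i => (t : ℂ) • Q i)
  set a : K ⊕ K → ℝ := Sum.elim l r
  have hM : IsPOVM M := by
    refine ⟨?_, ?_⟩
    · rintro (i | i)
      · exact (hP.povm.1 i).smul (by exact_mod_cast hs)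
      · exact (hQ.povm.1 i).smul (by exact_mod_cast ht)
    · simp only [M, Fintype.sum_sum_type, Sum.elim_inl, Sum.elim_inr, ← Finset.smul_sum,
        hP.povm.2, hQ.povm.2, ← add_smul, ← Complex.ofReal_add, hst, Complex.ofReal_one, one_smul]
  have ha : ∀ x, 0 < a x := by
    rintro (i | i)
    · exact hP.eigenvalue_pos h₁ i
    · exact hQ.eigenvalue_pos h₂ i
  have hsum : ∑ x, (a x : ℂ) • M x = (s : ℂ) • ω₁ + (t : ℂ) • ω₂ := by
    conv_rhs => rw [hP.eq_sum, hQ.eq_sum]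
    simp only [M, a, Fintype.sum_sum_type, Sum.elim_inl, Sum.elim_inr, Finset.smul_sum]
    congr 1 <;> exact Finset.sum_congr rfl fun i _ => smul_comm _ _ _
  have := sum_log_mul_outcome_le hM ha (posDef_sum_smul hM ha) hρ
  rw [hsum] at this
  refine le_trans (le_of_eq ?_) this
  simp only [logTrace, matLog, hP.re_trace_mul_cfc, hQ.re_trace_mul_cfc, Fintype.sum_sum_type, M, a,
    Sum.elim_inl, Sum.elim_inr, outcome, smul_mul_assoc, re_trace_real_smul, Finset.mul_sum]
  congr 1 <;> exact Finset.sum_congr rfl fun i _ => by ring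

theorem log_le_logTrace {ρ : Matrix K K ℂ} (hρ : IsDensity ρ) {ω : Matrix K K ℂ} {ε : ℝ}
    (hε : 0 < ε) (hω : (ω - (ε : ℂ) • (1 : Matrix K K ℂ)).PosSemidef) :
    Real.log ε ≤ logTrace ρ ω := by
  have hherm : ω.IsHermitian := by
    have h1 : ((ε : ℂ) • (1 : Matrix K K ℂ)).IsHermitian := by
      simp [IsHermitian, conjTranspose_smul]
    simpa using hω.1.add h1
  obtain ⟨l, P, hP⟩ := exists_isResolution hherm
  have h1 : Real.log ε = ∑ i, Real.log ε * outcome P ρ i := by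
    rw [← Finset.mul_sum, sum_outcome hP.povm, hρ.2]
    simp
  rw [logTrace, matLog, hP.re_trace_mul_cfc, h1]
  exact Finset.sum_le_sum fun i _ => mul_le_mul_of_nonneg_right
    (Real.log_le_log hε (hP.le_eigenvalue hω i)) (outcome_nonneg hP.povm hρ.1 i)

/-- The Hermitian part of a matrix. -/
def hermitianPart (X : Matrix K K ℂ) : Matrix K K ℂ := (1 / 2 : ℂ) • (X + Xᴴ)

omit [Fintype K] [DecidableEq K] in
theorem isHermitian_hermitianPart (X : Matrix K K ℂ) : (hermitianPart X).IsHermitian := by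
  simp [IsHermitian, hermitianPart, conjTranspose_smul, add_comm]

omit [Fintype K] [DecidableEq K] in
theorem hermitianPart_of_isHermitian {X : Matrix K K ℂ} (hX : X.IsHermitian) :
    hermitianPart X = X := by
  rw [hermitianPart, hX.eq, ← two_smul ℂ X, smul_smul]
  norm_num

omit [Fintype K] [DecidableEq K] in
theorem hermitianPart_combination (s t : ℝ) (X Y : Matrix K K ℂ) :
    hermitianPart (s • X + t • Y) = (s : ℂ) • hermitianPart X + (t : ℂ) • hermitianPart Y := by
  ext i j
  simp [hermitianPart]
  ring

-- Compactness of the unit sphere makes positivity of the quadratic form stable, uniformly in the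
-- vector, under small changes of the matrix.
omit [DecidableEq K] in
theorem eventually_posDef_hermitianPart {X : Matrix K K ℂ} (hX : (hermitianPart X).PosDef) :
    ∀ᶠ Y in 𝓝 X, (hermitianPart Y).PosDef := by
  have hc : Continuous fun z : Matrix K K ℂ × (K → ℂ) =>
      (star z.2 ⬝ᵥ (hermitianPart z.1 *ᵥ z.2)).re := by
    simp only [hermitianPart]
    fun_prop
  have h := (isCompact_sphere (0 : K → ℂ) 1).eventually_forall_of_forall_eventually
    (x₀ := X) (P := fun Y v => 0 < (star v ⬝ᵥ (hermitianPart Y *ᵥ v)).re) fun v hv => by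
      refine hc.continuousAt.eventually (lt_mem_nhds ?_)
      refine hX.re_dotProduct_pos ?_
      rintro rfl
      simp at hv
  filter_upwards [h] with Y hY
  refine .of_dotProduct_mulVec_pos (isHermitian_hermitianPart Y) fun v hv => ?_
  rw [Complex.lt_def]
  refine ⟨?_, by simpa using (im_quadratic_form (isHermitian_hermitianPart Y) v).symm⟩
  have hn : 0 < ‖v‖ := norm_pos_iff.2 hv
  have h1 := hY (((‖v‖⁻¹ : ℝ) : ℂ) • v) (by simp [norm_smul, hn.ne'])
  simp only [star_smul, mulVec_smul, smul_dotProduct, dotProduct_smul, smul_eq_mul,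
    Complex.star_def, Complex.conj_ofReal, Complex.re_ofReal_mul] at h1
  have hi : 0 < ‖v‖⁻¹ := inv_pos.2 hn
  exact (mul_pos_iff_of_pos_left hi).1 ((mul_pos_iff_of_pos_left hi).1 h1)

theorem exists_eventually_hermitianPart_ge {X : Matrix K K ℂ} (hX : X.PosDef) :
    ∃ ε : ℝ, 0 < ε ∧ ∀ᶠ Y in 𝓝 X,
      (hermitianPart Y - (ε : ℂ) • (1 : Matrix K K ℂ)).PosSemidef := by
  have hX' : (hermitianPart X).PosDef := by rwa [hermitianPart_of_isHermitian hX.isHermitian]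
  have hc : Continuous fun z : Matrix K K ℂ × ℝ => z.1 - (z.2 : ℂ) • (1 : Matrix K K ℂ) := by
    fun_prop
  -- Letting `Y → X` and `ε → 0⁺` jointly, `Y - ε` tends to `X`; openness of positivity then
  -- provides one `ε` that works for all `Y` near `X`.
  have h1 : Tendsto (fun z : Matrix K K ℂ × ℝ => z.1 - (z.2 : ℂ) • (1 : Matrix K K ℂ))
      (𝓝 X ×ˢ 𝓝[>] 0) (𝓝 X) := by
    have := hc.tendsto (X, 0)
    simp only [Complex.ofReal_zero, zero_smul, sub_zero] at this
    refine this.mono_left ?_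
    rw [nhds_prod_eq]
    exact Filter.prod_mono le_rfl nhdsWithin_le_nhds
  have h2 := (h1.eventually (eventually_posDef_hermitianPart hX'))
  rw [Filter.eventually_swap_iff] at h2
  obtain ⟨ε, hε, hε'⟩ := (h2.curry.and self_mem_nhdsWithin).exists
  refine ⟨ε, hε', hε.mono fun Y hY => ?_⟩
  convert hY.posSemidef using 1
  ext i j
  by_cases hij : i = j
  · subst hij
    simp [hermitianPart]
    ring
  · simp [hermitianPart, hij, mul_add]

/-- Real functionals on matrices are traces against Hermitian matrices, on Hermitian arguments. -/
theorem exists_trace_representation (φ : Matrix K K ℂ →ₗ[ℝ] ℝ) :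
    ∃ R : Matrix K K ℂ, R.IsHermitian ∧ ∀ X : Matrix K K ℂ, X.IsHermitian →
      φ X = (R * X).trace.re := by
  -- `Re ((a - i b)(x + i y)) = a x + b y`, so this entry recovers the values of `φ` on both the
  -- real and the imaginary unit in position `(i, j)`.
  set R₀ : Matrix K K ℂ := of fun j i => (φ (single i j 1) : ℂ) - Complex.I * φ (single i j Complex.I)
  have h0 : ∀ X : Matrix K K ℂ, φ X = (R₀ * X).trace.re := by
    intro X
    have hX : X = ∑ i, ∑ j, ((X i j).re • single i j (1 : ℂ) + (X i j).im • single i j Complex.I) := by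
      conv_lhs => rw [matrix_eq_sum_single X]
      refine Finset.sum_congr rfl fun i _ => Finset.sum_congr rfl fun j _ => ?_
      ext a b
      by_cases hab : i = a ∧ j = b
      · simp [single, hab, Complex.re_add_im]
      · simp [single, hab]
    conv_lhs => rw [hX]
    simp only [map_sum, map_add, map_smul, smul_eq_mul, trace, diag_apply, mul_apply, R₀, of_apply,
      Complex.re_sum]
    rw [Finset.sum_comm]
    refine Finset.sum_congr rfl fun i _ => Finset.sum_congr rfl fun j _ => ?_
    simp
    ring
  refine ⟨hermitianPart R₀, isHermitian_hermitianPart _, fun X hX => ?_⟩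
  have h1 : (R₀ᴴ * X).trace.re = (R₀ * X).trace.re := by
    have : star (R₀ * X).trace = (R₀ᴴ * X).trace := by
      rw [← trace_conjTranspose, conjTranspose_mul, hX.eq, trace_mul_comm]
    rw [← this]
    simp
  rw [h0, hermitianPart, smul_mul_assoc, add_mul, trace_smul, trace_add, smul_eq_mul,
    show (1 / 2 : ℂ) = ((1 / 2 : ℝ) : ℂ) by norm_num, Complex.re_ofReal_mul, Complex.add_re, h1]
  ring

end LogTrace

/-! ### Supergradients by separation of the hypograph -/

section Supergradient
variable {K : Type*} [Fintype K] [DecidableEq K]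

omit [Fintype K] [DecidableEq K] in
theorem posDef_combination {X Y : Matrix K K ℂ} (hX : X.PosDef) (hY : Y.PosDef) {s t : ℝ}
    (hs : 0 ≤ s) (ht : 0 ≤ t) (hst : s + t = 1) : ((s : ℂ) • X + (t : ℂ) • Y).PosDef := by
  rcases hs.eq_or_lt with rfl | hs'
  · have : t = 1 := by linarith
    subst this
    simpa using hY
  · exact (hX.smul (by exact_mod_cast hs')).add_posSemidef
      (hY.posSemidef.smul (by exact_mod_cast ht))

/-- The strict hypograph of `X ↦ tr[ρ log H]`, where `H` is the Hermitian part of `X`. -/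
def logHypograph (ρ : Matrix K K ℂ) : Set (Matrix K K ℂ × ℝ) :=
  {z | (hermitianPart z.1).PosDef ∧ z.2 < logTrace ρ (hermitianPart z.1)}

theorem convex_logHypograph {ρ : Matrix K K ℂ} (hρ : ρ.PosSemidef) :
    Convex ℝ (logHypograph ρ) := by
  rintro ⟨X, x⟩ ⟨hX, hx⟩ ⟨Y, y⟩ ⟨hY, hy⟩ s t hs ht hst
  simp only at hX hx hY hy
  refine ⟨?_, ?_⟩
  · simpa [hermitianPart_combination] using posDef_combination hX hY hs ht hst
  · have h1 := logTrace_concave hρ hX hY hs ht hst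
    simp only [Prod.smul_mk, Prod.mk_add_mk, hermitianPart_combination, smul_eq_mul]
    refine lt_of_lt_of_le ?_ h1
    rcases hs.eq_or_lt with rfl | hs'
    · have : t = 1 := by linarith
      subst this
      simpa using hy
    · nlinarith [mul_lt_mul_of_pos_left hx hs', mul_le_mul_of_nonneg_left hy.le ht]

/-- Pulling the hypograph back along the Hermitian part makes it a set with interior in the space of
all matrices. Near `X` the Hermitian parts stay above some `ε`, so `log ε` bounds `tr[ρ log ·]` from
below there. -/
theorem exists_mem_interior_logHypograph {ρ : Matrix K K ℂ} (hρ : IsDensity ρ) {X : Matrix K K ℂ}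
    (hX : X.PosDef) : ∃ t, (X, t) ∈ interior (logHypograph ρ) := by
  obtain ⟨ε, hε, hY⟩ := exists_eventually_hermitianPart_ge hX
  refine ⟨Real.log ε - 1, ?_⟩
  rw [mem_interior_iff_mem_nhds, nhds_prod_eq]
  filter_upwards [hY.prod_mk (gt_mem_nhds (sub_one_lt (Real.log ε)))] with z hz
  refine ⟨?_, hz.2.trans_le (log_le_logTrace hρ hε hz.1)⟩
  have h1 : ((ε : ℂ) • (1 : Matrix K K ℂ)).PosDef := PosDef.one.smul (by exact_mod_cast hε)
  simpa using h1.posSemidef_add hz.1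

/-- A supergradient of `ω ↦ tr[ρ log ω]` that certifies an upper bound `m` over a convex set. -/
theorem exists_supergradient {ρ : Matrix K K ℂ} (hρ : IsDensity ρ) {C : Set (Matrix K K ℂ)}
    (hC : Convex ℝ C) (hherm : ∀ X ∈ C, X.IsHermitian) {τ₀ : Matrix K K ℂ} (hτ₀ : τ₀ ∈ C)
    (hpos : τ₀.PosDef) {m : ℝ} (hm : ∀ X ∈ C, X.PosDef → logTrace ρ X ≤ m) :
    ∃ (R : Matrix K K ℂ) (c : ℝ), R.PosSemidef ∧
      (∀ ω : Matrix K K ℂ, ω.PosDef → logTrace ρ ω ≤ c + (R * ω).trace.re) ∧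
      ∀ X ∈ C, c + (R * X).trace.re ≤ m := by
  obtain ⟨t₀, ht₀⟩ := exists_mem_interior_logHypograph hρ hpos
  have hdisj : Disjoint (interior (logHypograph ρ)) (C ×ˢ Set.Ici m) := by
    rw [Set.disjoint_left]
    rintro ⟨X, t⟩ h1 ⟨hX, ht⟩
    obtain ⟨h2, h3⟩ := interior_subset h1
    simp only [hermitianPart_of_isHermitian (hherm X hX)] at h2 h3
    exact absurd (hm X hX h2) (not_le.2 (lt_of_le_of_lt ht h3))
  have hA := convex_logHypograph hρ.1
  obtain ⟨φ, u, hint, hB⟩ := geometric_hahn_banach_open hA.interior isOpen_interior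
    (hC.prod (convex_Ici m)) hdisj
  -- A convex set with nonempty interior lies in the closure of that interior, so the bound extends
  -- with `≤`.
  have hA' : ∀ z ∈ logHypograph ρ, φ z ≤ u := fun z hz => by
    have h1 : closure (interior (logHypograph ρ)) ⊆ {z | φ z ≤ u} :=
      closure_minimal (fun z hz => (hint z hz).le) (isClosed_le φ.continuous continuous_const)
    exact h1 (hA.closure_interior_eq_closure_of_nonempty_interior ⟨_, ht₀⟩ ▸ subset_closure hz)
  set lam : ℝ := φ (0, 1)
  have hsplit : ∀ X t, φ (X, t) = φ (X, 0) + t * lam := by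
    intro X t
    have : ((X, t) : Matrix K K ℂ × ℝ) = (X, 0) + t • (0, 1) := by simp
    rw [this, map_add, map_smul, smul_eq_mul]
  -- The hyperplane is not vertical: over the same base point `τ₀` there are an interior point of
  -- the hypograph and points of `C × [m, ∞)` above it.
  have hlam : 0 < lam := by
    have h1 := hint _ ht₀
    rw [hsplit] at h1
    have h2 : ∀ t, m ≤ t → u ≤ φ (τ₀, 0) + t * lam := fun t ht => by
      rw [← hsplit]
      exact hB (τ₀, t) ⟨hτ₀, ht⟩
    have h3 := h2 (max m (t₀ + 1)) (le_max_left _ _)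
    have h4 : t₀ + 1 ≤ max m (t₀ + 1) := le_max_right _ _
    have h5 : 0 < (max m (t₀ + 1) - t₀) * lam := by linarith
    exact (mul_pos_iff_of_pos_left (by linarith)).1 h5
  obtain ⟨R, hR, hφ⟩ := exists_trace_representation
    (-(lam⁻¹ • (φ.toLinearMap ∘ₗ LinearMap.inl ℝ (Matrix K K ℂ) ℝ)))
  have hφ' : ∀ X : Matrix K K ℂ, X.IsHermitian → φ (X, 0) = - lam * (R * X).trace.re := by
    intro X hX
    rw [← hφ X hX]
    simp [hlam.ne']
  have hupper : ∀ ω : Matrix K K ℂ, ω.PosDef →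
      logTrace ρ ω ≤ u / lam + (R * ω).trace.re := by
    intro ω hω
    refine le_of_forall_lt_imp_le_of_dense fun t ht => ?_
    have h1 := hA' (ω, t) ⟨by rwa [hermitianPart_of_isHermitian hω.isHermitian],
      by rwa [hermitianPart_of_isHermitian hω.isHermitian]⟩
    rw [hsplit, hφ' ω hω.isHermitian] at h1
    rw [← sub_le_iff_le_add, le_div_iff₀ hlam]
    linarith
  refine ⟨R, u / lam, posSemidef_of_re_trace hR fun v => ?_, hupper, fun X hX => ?_⟩
  -- As `log (1 + t v v*) ≥ 0` for `t ≥ 0`, the affine upper bound stays nonnegative along this ray.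
  -- A negative slope would contradict this for large `t`.
  · by_contra! hneg
    have hle : ∀ t : ℝ, 0 ≤ t →
        0 ≤ u / lam + R.trace.re + t * (R * vecMulVec v (star v)).trace.re := by
      intro t ht
      have hps : ((t : ℂ) • vecMulVec v (star v)).PosSemidef :=
        (posSemidef_vecMulVec_self_star v).smul (by exact_mod_cast ht)
      have h1 : Real.log 1 ≤ logTrace ρ (1 + (t : ℂ) • vecMulVec v (star v)) :=
        log_le_logTrace hρ one_pos (by simpa using hps)
      have h2 := hupper _ (PosDef.one.add_posSemidef hps)
      rw [Real.log_one] at h1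
      rw [mul_add, mul_one, trace_add, Complex.add_re, mul_smul_comm, re_trace_real_smul] at h2
      linarith
    set q := (R * vecMulVec v (star v)).trace.re
    have h0 := hle 0 le_rfl
    have h1 := hle ((u / lam + R.trace.re + 1) / (-q)) (div_nonneg (by linarith) (by linarith))
    have h2 : (u / lam + R.trace.re + 1) / (-q) * q = -(u / lam + R.trace.re + 1) := by
      rw [div_neg, neg_mul, div_mul_cancel₀ _ hneg.ne]
    linarith
  · have h1 := hB (X, m) ⟨hX, Set.self_mem_Ici⟩
    rw [hsplit, hφ' X (hherm X hX)] at h1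
    rw [← le_sub_iff_add_le, div_le_iff₀ hlam]
    linarith

end Supergradient

/-! ### Upper bound on the measured relative entropy -/

section Measured
variable {K : Type*} [Fintype K] [DecidableEq K]

/-- For a POVM with outcome weights `p` and `r`, test the hypothesis at `ω = ∑ a x • M x`. Jensen
bounds `∑ p log a` by `c + k ∑ a r`, and the optimal `a = p / (k r)` turns this into the divergence
bound. -/
theorem measuredRelEntropy_le {ρ R : Matrix K K ℂ} (hρ : IsDensity ρ) (hR : R.PosDef) {c k : ℝ}
    (hk : 0 < k)
    (h : ∀ ω : Matrix K K ℂ, ω.PosDef → logTrace ρ ω ≤ c + k * (R * ω).trace.re) :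
    measuredRelEntropy ρ R ≤ ((c + 1 + Real.log k : ℝ) : EReal) := by
  refine iSup_le fun n => iSup_le fun M => iSup_le fun hM => ?_
  have hp := outcome_nonneg hM hρ.1
  have hr := outcome_nonneg hM hR.posSemidef
  have hac : ∀ x, outcome M R x = 0 → outcome M ρ x = 0 := by
    intro x hx
    by_cases h0 : M x = 0
    · simp [outcome, h0]
    · exact absurd hx (outcome_pos hM hR h0).ne'
  rw [klDivergence, if_pos hac, EReal.coe_le_coe_iff]
  have hsum : ∑ x, outcome M ρ x = 1 := by rw [sum_outcome hM, hρ.2]; simp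
  have key : ∀ η : ℝ, 0 < η → ∑ x, outcome M ρ x * Real.log (outcome M ρ x / outcome M R x)
      ≤ c + 1 + Real.log k + η * (k * ∑ x, outcome M R x) := by
    intro η hη
    -- Jensen needs `a > 0`, so outcomes with `p = 0` receive `η`. The extra cost is at most `η * (k
    -- * ∑ r)` and vanishes as `η → 0`.
    set a : Fin n → ℝ := fun x =>
      if outcome M ρ x = 0 then η else outcome M ρ x / (k * outcome M R x)
    have hrpos : ∀ x, outcome M ρ x ≠ 0 → 0 < outcome M R x := fun x hx =>
      (hr x).lt_of_ne fun h0 => hx (hac x h0.symm)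
    have ha : ∀ x, 0 < a x := by
      intro x
      simp only [a]
      split_ifs with hx
      · exact hη
      · exact div_pos ((hp x).lt_of_ne (Ne.symm hx)) (mul_pos hk (hrpos x hx))
    have hω := posDef_sum_smul hM ha
    have h1 := (sum_log_mul_outcome_le hM ha hω hρ.1).trans (h _ hω)
    rw [re_trace_mul_sum_smul] at h1
    have h2 : ∑ x, outcome M ρ x * Real.log (a x)
        = ∑ x, outcome M ρ x * Real.log (outcome M ρ x / outcome M R x) - Real.log k := by
      rw [← one_mul (Real.log k), ← hsum, Finset.sum_mul, ← Finset.sum_sub_distrib]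
      refine Finset.sum_congr rfl fun x _ => ?_
      simp only [a]
      split_ifs with hx
      · simp [hx]
      · rw [mul_comm k, ← div_div, Real.log_div (div_ne_zero hx (hrpos x hx).ne') hk.ne', mul_sub]
    have h3 : k * ∑ x, a x * outcome M R x ≤ 1 + η * (k * ∑ x, outcome M R x) := by
      rw [← hsum, Finset.mul_sum, Finset.mul_sum, Finset.mul_sum, ← Finset.sum_add_distrib]
      refine Finset.sum_le_sum fun x _ => ?_
      simp only [a]
      split_ifs with hx
      · rw [hx]; apply le_of_eq; ring
      · have : k * (outcome M ρ x / (k * outcome M R x) * outcome M R x) = outcome M ρ x := by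
          have := (hrpos x hx).ne'
          field_simp
        rw [this]
        have := mul_nonneg hη.le (mul_nonneg hk.le (hr x))
        linarith
    linarith
  have hlim : Tendsto (fun η : ℝ => c + 1 + Real.log k + η * (k * ∑ x, outcome M R x)) (𝓝[>] 0)
      (𝓝 (c + 1 + Real.log k)) := by
    have hc : Continuous fun η : ℝ => c + 1 + Real.log k + η * (k * ∑ x, outcome M R x) := by
      fun_prop
    have := hc.tendsto 0
    rw [zero_mul, add_zero] at this
    exact this.mono_left nhdsWithin_le_nhds
  exact ge_of_tendsto hlim (by filter_upwards [self_mem_nhdsWithin] with η hη using key η hη)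

end Measured

/-! ### Partial traces and their adjoints -/

section Marginals
variable {A D F : Type*} [Fintype A] [Fintype D] [Fintype F]

theorem trace_kronecker_one_mul [DecidableEq F] (R : Matrix (A × D) (A × D) ℂ)
    (T : Matrix ((A × D) × F) ((A × D) × F) ℂ) :
    ((R ⊗ₖ (1 : Matrix F F ℂ)) * T).trace = (R * traceRight T).trace := by
  simp only [trace, diag_apply, mul_apply, Fintype.sum_prod_type (α₁ := A × D), kroneckerMap_apply,
    traceRight, of_apply, one_apply, mul_ite, mul_one, mul_zero, ite_mul, zero_mul,
    Finset.sum_ite_eq, Finset.mem_univ, if_true, Finset.mul_sum]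
  exact Finset.sum_congr rfl fun x _ => Finset.sum_comm

theorem trace_oneTensorAF_mul [DecidableEq D] (S : Matrix (A × F) (A × F) ℂ)
    (T : Matrix ((A × D) × F) ((A × D) × F) ℂ) :
    (oneTensorAF (D := D) S * T).trace = (S * marginalAF T).trace := by
  simp only [trace, diag_apply, mul_apply, Fintype.sum_prod_type, kroneckerMap_apply,
    oneTensorAF, submatrix_apply, marginalAF, of_apply, one_apply, ite_mul, one_mul, zero_mul,
    Finset.mul_sum]
  refine Finset.sum_congr rfl fun a _ => ?_
  rw [Finset.sum_comm]
  refine Finset.sum_congr rfl fun f _ => ?_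
  rw [Finset.sum_comm]
  refine Finset.sum_congr rfl fun a' _ => ?_
  rw [Finset.sum_comm (s := Finset.univ (α := F))]
  refine Finset.sum_congr rfl fun d _ => ?_
  rw [Finset.sum_comm]
  refine Finset.sum_congr rfl fun f' _ => ?_
  simp

omit [Fintype A] [Fintype D] [Fintype F] in
theorem isHermitian_oneTensorAF [DecidableEq D] {S : Matrix (A × F) (A × F) ℂ}
    (hS : S.IsHermitian) : (oneTensorAF (D := D) S).IsHermitian := by
  refine IsHermitian.submatrix ?_ _
  rw [IsHermitian, conjTranspose_kronecker, hS.eq, conjTranspose_one]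

omit [Fintype A] [Fintype D] [Fintype F] in
theorem isHermitian_kronecker_one [DecidableEq F] {R : Matrix (A × D) (A × D) ℂ}
    (hR : R.IsHermitian) : (R ⊗ₖ (1 : Matrix F F ℂ)).IsHermitian := by
  rw [IsHermitian, conjTranspose_kronecker, hR.eq, conjTranspose_one]

theorem trace_marginalAF (T : Matrix ((A × D) × F) ((A × D) × F) ℂ) :
    (marginalAF T).trace = T.trace := by
  simp only [trace, diag_apply, Fintype.sum_prod_type, marginalAF, of_apply]
  exact Finset.sum_congr rfl fun a _ => Finset.sum_comm

omit [Fintype A] [Fintype F] in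
theorem marginalAF_eq_sum (T : Matrix ((A × D) × F) ((A × D) × F) ℂ) :
    marginalAF T = ∑ d, T.submatrix (fun x : A × F => ((x.1, d), x.2)) fun x => ((x.1, d), x.2) := by
  ext x y
  simp [marginalAF, Matrix.sum_apply]

omit [Fintype A] [Fintype F] in
theorem posSemidef_marginalAF {T : Matrix ((A × D) × F) ((A × D) × F) ℂ} (hT : T.PosSemidef) :
    (marginalAF T).PosSemidef := by
  rw [marginalAF_eq_sum]
  exact posSemidef_sum _ fun d _ => hT.submatrix _

omit [Fintype A] [Fintype F] in
theorem isHermitian_marginalAF {T : Matrix ((A × D) × F) ((A × D) × F) ℂ} (hT : T.IsHermitian) :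
    (marginalAF T).IsHermitian := by
  ext x y
  simp only [marginalAF, conjTranspose_apply, of_apply, star_sum]
  exact Finset.sum_congr rfl fun d _ => hT.apply _ _

theorem posSemidef_traceRight {K L : Type*} [Fintype L] {T : Matrix (K × L) (K × L) ℂ}
    (hT : T.PosSemidef) : (traceRight T).PosSemidef := by
  have : traceRight T = ∑ l, T.submatrix (fun x => (x, l)) fun x => (x, l) := by
    ext x y
    simp [traceRight, Matrix.sum_apply]
  rw [this]
  exact posSemidef_sum _ fun l _ => hT.submatrix _

omit [Fintype A] [Fintype F] in
theorem marginalAF_oneTensorAF [DecidableEq D] (S : Matrix (A × F) (A × F) ℂ) :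
    marginalAF (oneTensorAF (D := D) S) = (Fintype.card D : ℂ) • S := by
  ext x y
  simp [marginalAF, oneTensorAF]

theorem posSemidef_oneTensorAF [DecidableEq D] {S : Matrix (A × F) (A × F) ℂ}
    (hS : S.PosSemidef) : (oneTensorAF (D := D) S).PosSemidef :=
  (PosSemidef.one.kronecker hS).submatrix _

end Marginals

/-! ### Convexity and compactness of the density operators -/

section Density
variable {K : Type*} [Fintype K]

theorem exists_eq_mul_conjTranspose {X : Matrix K K ℂ} (hX : X.PosSemidef) :
    ∃ Z : Matrix K K ℂ, X = Z * Zᴴ := by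
  classical
  obtain ⟨l, P, hP⟩ := exists_isResolution hX.1
  refine ⟨∑ i, ((√(l i) : ℝ) : ℂ) • P i, ?_⟩
  have h1 : (∑ i, ((√(l i) : ℝ) : ℂ) • P i)ᴴ = ∑ i, ((√(l i) : ℝ) : ℂ) • P i := by
    rw [conjTranspose_sum]
    simp only [conjTranspose_smul, (hP.povm.1 _).1.eq, Complex.star_def, Complex.conj_ofReal]
  rw [h1, hP.sum_smul_mul_sum_smul]
  conv_lhs => rw [hP.eq_sum]
  refine Finset.sum_congr rfl fun i _ => ?_
  rw [← Complex.ofReal_mul, Real.mul_self_sqrt (hP.eigenvalue_nonneg hX i)]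

theorem convex_setOf_isDensity : Convex ℝ {X : Matrix K K ℂ | IsDensity X} := by
  rintro X ⟨hX, hX1⟩ Y ⟨hY, hY1⟩ s t hs ht hst
  refine ⟨(hX.smul hs).add (hY.smul ht), ?_⟩
  rw [trace_add, trace_smul, trace_smul, hX1, hY1]
  rw [← add_smul, hst, one_smul]

/-- Density operators are the image of the Hilbert–Schmidt unit sphere under the continuous map `Z ↦
Z Zᴴ`. -/
theorem isCompact_setOf_isDensity : IsCompact {X : Matrix K K ℂ | IsDensity X} := by
  have himage : {X : Matrix K K ℂ | IsDensity X}
      = (fun Z : Matrix K K ℂ => Z * Zᴴ) '' {Z | (Z * Zᴴ).trace = 1} := by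
    ext X
    constructor
    · rintro ⟨h1, h2⟩
      obtain ⟨Z, rfl⟩ := exists_eq_mul_conjTranspose h1
      exact ⟨Z, h2, rfl⟩
    · rintro ⟨Z, hZ, rfl⟩
      exact ⟨posSemidef_self_mul_conjTranspose Z, hZ⟩
  rw [himage]
  refine IsCompact.image ?_ (by fun_prop)
  have hbox : IsCompact (Set.univ.pi fun _ : K => Set.univ.pi fun _ : K =>
      Metric.closedBall (0 : ℂ) 1) :=
    isCompact_univ_pi fun _ => isCompact_univ_pi fun _ => isCompact_closedBall _ _
  refine IsCompact.of_isClosed_subset hbox (isClosed_eq (by fun_prop) continuous_const) ?_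
  intro Z hZ i _ j _
  have h1 : ∑ i, ∑ j, ‖Z i j‖ ^ 2 = 1 := by
    have h2 : ((Z * Zᴴ).trace).re = 1 := by rw [hZ]; simp
    rw [← h2]
    simp [trace, mul_apply, Complex.re_sum, Complex.mul_conj, Complex.normSq_eq_norm_sq,
      -Complex.ofReal_pow]
  have h3 : ‖Z i j‖ ^ 2 ≤ 1 := by
    rw [← h1]
    refine (Finset.single_le_sum (f := fun j => ‖Z i j‖ ^ 2) (fun _ _ => sq_nonneg _)
      (Finset.mem_univ j)).trans ?_
    exact Finset.single_le_sum (f := fun i => ∑ j, ‖Z i j‖ ^ 2)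
      (fun _ _ => Finset.sum_nonneg fun _ _ => sq_nonneg _) (Finset.mem_univ i)
  rw [mem_closedBall_zero_iff]
  exact (sq_le_one_iff₀ (norm_nonneg _)).1 h3

end Density

/-! ### Semidefinite duality with a prescribed marginal -/

section Duality
variable {A D F : Type*} [Fintype A] [Fintype D] [Fintype F]

/-- Strong duality for the maximization of `tr[(R ⊗ 1) T]` over `T ≥ 0` with prescribed
marginal `κ` on `AF`. -/
theorem exists_dual_feasible [DecidableEq A] [DecidableEq D] [DecidableEq F] [Nonempty D]
    {R : Matrix (A × D) (A × D) ℂ} (hR : R.IsHermitian)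
    {κ : Matrix (A × F) (A × F) ℂ} (hκ : IsDensity κ) {k : ℝ}
    (hk : ∀ T : Matrix ((A × D) × F) ((A × D) × F) ℂ, T.PosSemidef → marginalAF T = κ →
      ((R ⊗ₖ (1 : Matrix F F ℂ)) * T).trace.re ≤ k) {δ : ℝ} (hδ : 0 < δ) :
    ∃ S : Matrix (A × F) (A × F) ℂ, S.IsHermitian ∧
      (oneTensorAF S - R ⊗ₖ (1 : Matrix F F ℂ)).PosSemidef ∧ (S * κ).trace.re ≤ k + δ := by
  set L : Matrix ((A × D) × F) ((A × D) × F) ℂ →ₗ[ℝ] Matrix (A × F) (A × F) ℂ × ℝ :=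
    { toFun := fun T => (marginalAF T, ((R ⊗ₖ (1 : Matrix F F ℂ)) * T).trace.re)
      map_add' := fun X Y => by
        ext <;> simp [marginalAF, mul_add, Finset.sum_add_distrib]
      map_smul' := fun a X => by
        ext <;> simp [marginalAF, Finset.mul_sum] }
  have hLc : Continuous L := L.continuous_of_finiteDimensional
  -- A density operator with marginal `κ` has value at most `k`, so the slack `δ` keeps the compact
  -- image of `L` off the closed ray.
  have hdisj : Disjoint (L '' {T | IsDensity T}) ({κ} ×ˢ Set.Ici (k + δ)) := by
    rw [Set.disjoint_left]
    rintro _ ⟨T, hT, rfl⟩ ⟨h1, h2⟩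
    have h3 := hk T hT.1 h1
    have h4 : k + δ ≤ ((R ⊗ₖ (1 : Matrix F F ℂ)) * T).trace.re := h2
    linarith
  have : LocallyConvexSpace ℝ (Matrix (A × F) (A × F) ℂ) :=
    inferInstanceAs (LocallyConvexSpace ℝ (A × F → A × F → ℂ))
  obtain ⟨φ, u, v, h1, huv, h2⟩ := geometric_hahn_banach_compact_closed
    (convex_setOf_isDensity.linear_image L) (isCompact_setOf_isDensity.image hLc)
    ((convex_singleton κ).prod (convex_Ici (k + δ))) (isClosed_singleton.prod isClosed_Ici) hdisj
  set lam : ℝ := φ (0, 1)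
  have hsplit : ∀ X t, φ (X, t) = φ (X, 0) + t * lam := by
    intro X t
    have : ((X, t) : Matrix (A × F) (A × F) ℂ × ℝ) = (X, 0) + t • (0, 1) := by simp
    rw [this, map_add, map_smul, smul_eq_mul]
  obtain ⟨S₀, hS₀, hφ⟩ := exists_trace_representation
    (φ.toLinearMap ∘ₗ LinearMap.inl ℝ (Matrix (A × F) (A × F) ℂ) ℝ)
  have hφ' : ∀ X : Matrix (A × F) (A × F) ℂ, X.IsHermitian → φ (X, 0) = (S₀ * X).trace.re :=
    fun X hX => hφ X hX
  have hT : ∀ T : Matrix ((A × D) × F) ((A × D) × F) ℂ, IsDensity T →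
      (S₀ * marginalAF T).trace.re + ((R ⊗ₖ (1 : Matrix F F ℂ)) * T).trace.re * lam < u := by
    intro T hT
    rw [← hφ' _ (isHermitian_marginalAF hT.1.1), ← hsplit]
    exact h1 _ ⟨T, hT, rfl⟩
  have hs : ∀ s, k + δ ≤ s → v < (S₀ * κ).trace.re + s * lam := by
    intro s hs
    rw [← hφ' _ hκ.1.1, ← hsplit]
    exact h2 _ ⟨rfl, hs⟩
  have hcard : (Fintype.card D : ℂ) ≠ 0 := by simp
  -- The product of `κ` with the maximally mixed state on `D` is primal feasible; comparing it with
  -- the ray over `κ` forces `lam > 0`.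
  set T₀ : Matrix ((A × D) × F) ((A × D) × F) ℂ := (Fintype.card D : ℂ)⁻¹ • oneTensorAF κ
  have hmarg : marginalAF T₀ = κ := by
    have : marginalAF T₀ = (Fintype.card D : ℂ)⁻¹ • marginalAF (oneTensorAF (D := D) κ) := by
      ext x y
      simp [T₀, marginalAF, Finset.mul_sum]
    rw [this, marginalAF_oneTensorAF, smul_smul, inv_mul_cancel₀ hcard, one_smul]
  have hT₀ : IsDensity T₀ := by
    refine ⟨(posSemidef_oneTensorAF hκ.1).smul ?_, by rw [← trace_marginalAF, hmarg, hκ.2]⟩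
    exact inv_nonneg.2 (Nat.cast_nonneg _)
  have hlam : 0 < lam := by
    have h3 := hT T₀ hT₀
    have h4 := hk T₀ hT₀.1 hmarg
    have h5 := hs _ le_rfl
    rw [hmarg] at h3
    have h6 : 0 < (k + δ - ((R ⊗ₖ (1 : Matrix F F ℂ)) * T₀).trace.re) * lam := by linarith
    exact (mul_pos_iff_of_pos_left (by linarith)).1 h6
  have hScale : ∀ X : Matrix (A × F) (A × F) ℂ,
      ((((lam⁻¹ : ℝ) : ℂ) • ((u : ℂ) • (1 : Matrix (A × F) (A × F) ℂ) - S₀)) * X).trace.re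
        = lam⁻¹ * (u * X.trace.re - (S₀ * X).trace.re) := by
    intro X
    rw [smul_mul_assoc, re_trace_real_smul, sub_mul, smul_mul_assoc, one_mul, trace_sub,
      Complex.sub_re, re_trace_real_smul]
  have hSherm : (((lam⁻¹ : ℝ) : ℂ) • ((u : ℂ) • (1 : Matrix (A × F) (A × F) ℂ) - S₀)).IsHermitian := by
    simp [IsHermitian, conjTranspose_smul, hS₀.eq]
  -- The witness is `S = (u - S₀) / lam`. The bound on density operators, extended to all rank-one
  -- operators by homogeneity, is the operator inequality; the bound at `κ` is the estimate of `tr[S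
  -- κ]`.
  refine ⟨_, hSherm, posSemidef_of_re_trace ((isHermitian_oneTensorAF hSherm).sub
    (isHermitian_kronecker_one hR)) fun w => ?_, ?_⟩
  · set T := vecMulVec w (star w)
    have hTpos : T.PosSemidef := posSemidef_vecMulVec_self_star w
    rw [sub_mul, trace_sub, Complex.sub_re, trace_oneTensorAF_mul, hScale, trace_marginalAF]
    rcases eq_or_ne T.trace 0 with h0 | h0
    · have : T = 0 := hTpos.trace_eq_zero_iff.1 h0
      simp [this, marginalAF_eq_sum]
    · have hle := Complex.le_def.1 hTpos.trace_nonneg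
      have htr : T.trace = ((T.trace.re : ℝ) : ℂ) := by
        apply Complex.ext
        · simp
        · simpa using hle.2.symm
      have hpos : 0 < T.trace.re := lt_of_le_of_ne hle.1 fun h => h0 (by rw [htr, ← h]; simp)
      have h3 := hT (((T.trace.re⁻¹ : ℝ) : ℂ) • T) ⟨hTpos.smul (by exact_mod_cast inv_nonneg.2 hle.1), by
        rw [trace_smul, htr, smul_eq_mul, Complex.ofReal_re, ← Complex.ofReal_mul, inv_mul_cancel₀ hpos.ne',
          Complex.ofReal_one]⟩
      have h4 : marginalAF (((T.trace.re⁻¹ : ℝ) : ℂ) • T)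
          = ((T.trace.re⁻¹ : ℝ) : ℂ) • marginalAF T := by
        ext x y
        simp [marginalAF, Finset.mul_sum]
      rw [h4, mul_smul_comm, mul_smul_comm, re_trace_real_smul, re_trace_real_smul, mul_assoc,
        ← mul_add, inv_mul_lt_iff₀ hpos] at h3
      rw [sub_nonneg, le_inv_mul_iff₀ hlam]
      linarith
  · have h5 := hs _ le_rfl
    rw [hScale, hκ.2, inv_mul_le_iff₀ hlam]
    simp only [Complex.one_re, mul_one]
    linarith
end Duality

/-! ### Contractions relating matrices with equal Gram matrices -/

section Contraction

/-- If `‖f v‖ = ‖g v‖` for all `v`, then `g` factors through `f` by a contraction. -/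
theorem exists_contraction_of_norm_eq {U V W : Type*} [AddCommGroup U] [Module ℂ U]
    [NormedAddCommGroup V] [InnerProductSpace ℂ V] [FiniteDimensional ℂ V]
    [NormedAddCommGroup W] [InnerProductSpace ℂ W]
    (f : U →ₗ[ℂ] V) (g : U →ₗ[ℂ] W) (h : ∀ v, ‖f v‖ = ‖g v‖) :
    ∃ c : V →ₗ[ℂ] W, (∀ v, c (f v) = g v) ∧ ∀ w, ‖c w‖ ≤ ‖w‖ := by
  obtain ⟨s, hs⟩ := f.rangeRestrict.exists_rightInverse_of_surjective f.range_rangeRestrict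
  have hs' : ∀ w : LinearMap.range f, f (s w) = w := fun w => by
    have := congrArg Subtype.val (LinearMap.congr_fun hs w)
    simpa using this
  have hg : ∀ w : LinearMap.range f, ‖g (s w)‖ = ‖w‖ := fun w => by
    rw [← h, hs']
    rfl
  -- Project onto the range of `f`, lift by a section `s` and apply `g`. The choice of lift is
  -- immaterial, since equal norms give `f` and `g` the same kernel.
  refine ⟨g ∘ₗ s ∘ₗ (LinearMap.range f).orthogonalProjectionOnto.toLinearMap, fun v => ?_, fun w => ?_⟩
  · have h1 : (LinearMap.range f).orthogonalProjectionOnto (f v) = ⟨f v, LinearMap.mem_range_self f v⟩ :=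
      Submodule.orthogonalProjectionOnto_mem_subspace_eq_self ⟨f v, LinearMap.mem_range_self f v⟩
    simp only [LinearMap.comp_apply, ContinuousLinearMap.coe_coe, h1]
    rw [← sub_eq_zero, ← map_sub, ← norm_eq_zero, ← h, map_sub, hs', sub_self, norm_zero]
  · simp only [LinearMap.comp_apply, ContinuousLinearMap.coe_coe, hg]
    exact Submodule.norm_orthogonalProjectionOnto_apply_le _ _

theorem re_star_dotProduct_self {K : Type*} [Fintype K] (v : K → ℂ) :
    (star v ⬝ᵥ v).re = ‖WithLp.toLp 2 v‖ ^ 2 := by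
  rw [EuclideanSpace.norm_sq_eq]
  simp [dotProduct, ← Complex.normSq_eq_norm_sq, Complex.normSq_apply]

theorem star_dotProduct_conjTranspose_mul_self {K L : Type*} [Fintype K] [Fintype L]
    (M : Matrix K L ℂ) (v : L → ℂ) :
    star v ⬝ᵥ ((Mᴴ * M) *ᵥ v) = star (M *ᵥ v) ⬝ᵥ (M *ᵥ v) := by
  rw [← mulVec_mulVec, dotProduct_mulVec, star_mulVec]

theorem norm_sq_toEuclideanLin {K L : Type*} [Fintype K] [Fintype L] [DecidableEq L]
    (M : Matrix K L ℂ) (v : EuclideanSpace ℂ L) :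
    ‖Matrix.toEuclideanLin M v‖ ^ 2 = (star v.ofLp ⬝ᵥ ((Mᴴ * M) *ᵥ v.ofLp)).re := by
  rw [star_dotProduct_conjTranspose_mul_self, re_star_dotProduct_self]
  rfl

/-- Two matrices with the same Gram matrix are related by a contraction. -/
theorem exists_contraction_of_conjTranspose_mul_self_eq {K L N : Type*} [Fintype K] [Fintype L]
    [Fintype N] [DecidableEq K] {M : Matrix K N ℂ} {M' : Matrix L N ℂ} (h : Mᴴ * M = M'ᴴ * M') :
    ∃ C : Matrix L K ℂ, M' = C * M ∧ (1 - Cᴴ * C).PosSemidef := by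
  classical
  obtain ⟨c, hc, hc'⟩ := exists_contraction_of_norm_eq (Matrix.toEuclideanLin M)
    (Matrix.toEuclideanLin M') fun v => by
      have h1 := norm_sq_toEuclideanLin M v
      rw [h, ← norm_sq_toEuclideanLin] at h1
      exact (sq_eq_sq₀ (norm_nonneg _) (norm_nonneg _)).1 h1
  set C := Matrix.toEuclideanLin.symm c
  have hC : c = Matrix.toEuclideanLin C := by simp [C]
  have hCv : ∀ v : K → ℂ, WithLp.toLp 2 (C *ᵥ v) = c (WithLp.toLp 2 v) := fun v => by
    rw [hC]; rfl
  refine ⟨C, ?_, ?_⟩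
  · apply Matrix.toEuclideanLin.injective
    ext1 v
    rw [← hc v, hC]
    simp [Matrix.toLpLin_apply, mulVec_mulVec]
  · refine .of_dotProduct_mulVec_nonneg (isHermitian_one.sub (isHermitian_conjTranspose_mul_self C))
      fun v => ?_
    rw [Complex.le_def]
    refine ⟨?_, by simpa using (im_quadratic_form (isHermitian_one.sub
      (isHermitian_conjTranspose_mul_self C)) v).symm⟩
    rw [sub_mulVec, dotProduct_sub, one_mulVec, star_dotProduct_conjTranspose_mul_self,
      Complex.sub_re, re_star_dotProduct_self, re_star_dotProduct_self, hCv]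
    have := pow_le_pow_left₀ (norm_nonneg _) (hc' (WithLp.toLp 2 v)) 2
    simp only [Complex.zero_re]
    linarith

end Contraction

/-! ### Completely positive maps and channels -/

section Channels
variable {D E G : Type*} [Fintype D] [Fintype E]

/-- Complete positivity. -/
def IsCompletelyPositive (Γ : Matrix E E ℂ →ₗ[ℂ] Matrix D D ℂ) : Prop :=
  ∀ (n : ℕ) (X : Matrix (Fin n × E) (Fin n × E) ℂ), X.PosSemidef → (idTensor Γ X).PosSemidef

omit [Fintype D] [Fintype E] in
theorem idTensor_add {K : Type*} (Γ : Matrix E E ℂ →ₗ[ℂ] Matrix D D ℂ)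
    (X Y : Matrix (K × E) (K × E) ℂ) : idTensor Γ (X + Y) = idTensor Γ X + idTensor Γ Y := by
  ext x y
  exact congrFun (congrFun (map_add Γ (of fun e e' => X (x.1, e) (y.1, e'))
    (of fun e e' => Y (x.1, e) (y.1, e'))) x.2) y.2

omit [Fintype D] [Fintype E] in
theorem idTensor_zero {K : Type*} (Γ : Matrix E E ℂ →ₗ[ℂ] Matrix D D ℂ) :
    idTensor Γ (0 : Matrix (K × E) (K × E) ℂ) = 0 := by
  ext x y
  exact congrFun (congrFun (map_zero Γ) x.2) y.2

omit [Fintype D] [Fintype E] in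
theorem idTensor_sum {K ι : Type*} (s : Finset ι) (Γ : Matrix E E ℂ →ₗ[ℂ] Matrix D D ℂ)
    (X : ι → Matrix (K × E) (K × E) ℂ) :
    idTensor Γ (∑ i ∈ s, X i) = ∑ i ∈ s, idTensor Γ (X i) := by
  classical
  induction s using Finset.induction_on with
  | empty => simp [idTensor_zero]
  | insert i s hi ih => rw [Finset.sum_insert hi, Finset.sum_insert hi, idTensor_add, ih]

omit [Fintype D] [Fintype E] in
theorem add_idTensor {K : Type*} (Γ Γ' : Matrix E E ℂ →ₗ[ℂ] Matrix D D ℂ)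
    (X : Matrix (K × E) (K × E) ℂ) : idTensor (Γ + Γ') X = idTensor Γ X + idTensor Γ' X := rfl

omit [Fintype D] [Fintype E] in
theorem smul_idTensor {K : Type*} (a : ℂ) (Γ : Matrix E E ℂ →ₗ[ℂ] Matrix D D ℂ)
    (X : Matrix (K × E) (K × E) ℂ) : idTensor (a • Γ) X = a • idTensor Γ X := rfl

omit [Fintype D] [Fintype E] in
theorem sum_idTensor {K ι : Type*} (s : Finset ι) (Γ : ι → Matrix E E ℂ →ₗ[ℂ] Matrix D D ℂ)
    (X : Matrix (K × E) (K × E) ℂ) : idTensor (∑ i ∈ s, Γ i) X = ∑ i ∈ s, idTensor (Γ i) X := by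
  ext x y
  simp [idTensor, Matrix.sum_apply]

omit [Fintype D] [Fintype E] in
theorem IsCompletelyPositive.posSemidef_idTensor {Γ : Matrix E E ℂ →ₗ[ℂ] Matrix D D ℂ}
    (h : IsCompletelyPositive Γ) {K : Type*} [Fintype K] {X : Matrix (K × E) (K × E) ℂ}
    (hX : X.PosSemidef) : (idTensor Γ X).PosSemidef := by
  set e := Fintype.equivFin K
  have h1 := h _ (X.submatrix (Prod.map e.symm id) (Prod.map e.symm id)) (hX.submatrix _)
  have h2 := h1.submatrix (Prod.map e id : K × D → Fin (Fintype.card K) × D)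
  convert h2 using 1
  ext x y
  simp [idTensor]

/-- The map `X ↦ V X Vᴴ`. -/
def conjMap (V : Matrix D E ℂ) : Matrix E E ℂ →ₗ[ℂ] Matrix D D ℂ where
  toFun X := V * X * Vᴴ
  map_add' X Y := by rw [Matrix.mul_add, Matrix.add_mul]
  map_smul' a X := by simp

omit [Fintype D] in
theorem idTensor_conjMap_vecMulVec {K : Type*} (V : Matrix D E ℂ) (v : K × E → ℂ) :
    idTensor (conjMap V) (vecMulVec v (star v)) =
      vecMulVec (fun x : K × D => ∑ e, V x.2 e * v (x.1, e))
        (star fun x : K × D => ∑ e, V x.2 e * v (x.1, e)) := by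
  ext x y
  simp only [idTensor, conjMap, LinearMap.coe_mk, AddHom.coe_mk, of_apply, vecMulVec_apply,
    Pi.star_apply, mul_apply, conjTranspose_apply, star_sum, star_mul', Finset.sum_mul,
    Finset.mul_sum]
  exact Finset.sum_congr rfl fun e _ => Finset.sum_congr rfl fun e' _ => by ring

theorem isCompletelyPositive_conjMap (V : Matrix D E ℂ) : IsCompletelyPositive (conjMap V) := by
  intro n X hX
  obtain ⟨m, v, rfl⟩ := Matrix.posSemidef_iff_eq_sum_vecMulVec.mp hX
  rw [idTensor_sum]
  refine posSemidef_sum _ fun i _ => ?_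
  rw [idTensor_conjMap_vecMulVec]
  exact posSemidef_vecMulVec_self_star _

omit [Fintype D] [Fintype E] in
theorem isCompletelyPositive_sum {ι : Type*} (s : Finset ι)
    {Γ : ι → Matrix E E ℂ →ₗ[ℂ] Matrix D D ℂ} (h : ∀ i ∈ s, IsCompletelyPositive (Γ i)) :
    IsCompletelyPositive (∑ i ∈ s, Γ i) := by
  intro n X hX
  rw [sum_idTensor]
  exact posSemidef_sum _ fun i hi => h i hi n X hX

/-- The channel that replaces its input by the maximally mixed state. -/
def replacement (D E : Type*) [Fintype D] [DecidableEq D] [Fintype E] :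
    Matrix E E ℂ →ₗ[ℂ] Matrix D D ℂ where
  toFun X := X.trace • ((Fintype.card D : ℂ)⁻¹ • (1 : Matrix D D ℂ))
  map_add' X Y := by rw [trace_add, add_smul]
  map_smul' a X := by rw [trace_smul, smul_assoc, RingHom.id_apply]

theorem idTensor_replacement [DecidableEq D] {K : Type*} (X : Matrix (K × E) (K × E) ℂ) :
    idTensor (replacement D E) X = traceRight X ⊗ₖ ((Fintype.card D : ℂ)⁻¹ • (1 : Matrix D D ℂ)) := by
  ext x y
  simp [idTensor, replacement, traceRight, trace]

theorem isChannel_replacement [DecidableEq D] [Nonempty D] : IsChannel (replacement D E) where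
  completelyPositive n X hX := by
    rw [idTensor_replacement]
    exact (posSemidef_traceRight hX).kronecker
      (PosSemidef.one.smul (inv_nonneg.2 (Nat.cast_nonneg _)))
  tracePreserving X := by
    simp [replacement]

theorem posDef_idTensor_replacement [DecidableEq D] [Nonempty D] {K : Type*} [Fintype K]
    {X : Matrix (K × E) (K × E) ℂ} (hX : (traceRight X).PosDef) :
    (idTensor (replacement D E) X).PosDef := by
  rw [idTensor_replacement]
  exact hX.kronecker (PosDef.one.smul (inv_pos.2 (by simp [Fintype.card_pos])))

omit [Fintype D] [Fintype E] in
theorem comp_idTensor {B K : Type*} (Γ : Matrix E E ℂ →ₗ[ℂ] Matrix D D ℂ)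
    (Γ' : Matrix B B ℂ →ₗ[ℂ] Matrix E E ℂ) (X : Matrix (K × B) (K × B) ℂ) :
    idTensor (Γ ∘ₗ Γ') X = idTensor Γ (idTensor Γ' X) := rfl

theorem trace_conjMap (V : Matrix D E ℂ) (X : Matrix E E ℂ) :
    (conjMap V X).trace = ((Vᴴ * V) * X).trace := by
  change (V * X * Vᴴ).trace = _
  rw [trace_mul_cycle]

/-- A trace non-increasing Kraus family extends to a channel. -/
theorem exists_isChannel_sub_isCompletelyPositive [DecidableEq D] [Nonempty D] [DecidableEq E]
    [Fintype G] (V : G → Matrix D E ℂ) (hV : (1 - ∑ g, (V g)ᴴ * V g).PosSemidef) :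
    ∃ Γ Γ' : Matrix E E ℂ →ₗ[ℂ] Matrix D D ℂ, IsChannel Γ ∧ IsCompletelyPositive Γ' ∧
      Γ = ∑ g, conjMap (V g) + Γ' := by
  obtain ⟨Z, hZ⟩ := exists_eq_mul_conjTranspose hV
  -- With `Z Zᴴ` the trace defect, conjugation by `Zᴴ` carries exactly the missing trace, and the
  -- replacement channel sends it to `D`.
  have hrem : IsCompletelyPositive (replacement D E ∘ₗ conjMap Zᴴ) := fun n X hX => by
    rw [comp_idTensor]
    exact isChannel_replacement.completelyPositive n _ (isCompletelyPositive_conjMap Zᴴ n X hX)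
  have hsum := isCompletelyPositive_sum Finset.univ fun g (_ : g ∈ Finset.univ) =>
    isCompletelyPositive_conjMap (V g)
  refine ⟨_, _, ⟨fun n X hX => ?_, fun X => ?_⟩, hrem, rfl⟩
  · rw [add_idTensor]
    exact (hsum n X hX).add (hrem n X hX)
  · rw [LinearMap.add_apply, trace_add, LinearMap.sum_apply, LinearMap.comp_apply,
      isChannel_replacement.tracePreserving, trace_conjMap, conjTranspose_conjTranspose, ← hZ,
      trace_sum]
    simp only [trace_conjMap]
    rw [← trace_sum, ← Finset.sum_mul, ← trace_add, ← add_mul, add_sub_cancel, one_mul]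

theorem IsChannel.combination {Γ Γ' : Matrix E E ℂ →ₗ[ℂ] Matrix D D ℂ} (h : IsChannel Γ)
    (h' : IsChannel Γ') {s t : ℝ} (hs : 0 ≤ s) (ht : 0 ≤ t) (hst : s + t = 1) :
    IsChannel ((s : ℂ) • Γ + (t : ℂ) • Γ') where
  completelyPositive n X hX := by
    rw [add_idTensor, smul_idTensor, smul_idTensor]
    exact ((h.completelyPositive n X hX).smul (by exact_mod_cast hs)).add
      ((h'.completelyPositive n X hX).smul (by exact_mod_cast ht))
  tracePreserving X := by
    rw [LinearMap.add_apply, trace_add, LinearMap.smul_apply, LinearMap.smul_apply, trace_smul,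
      trace_smul, h.tracePreserving, h'.tracePreserving, ← add_smul, ← Complex.ofReal_add, hst,
      Complex.ofReal_one, one_smul]

end Channels

/-! ### Channels and extensions with a fixed `AF`-marginal -/

section Recovery
variable {A D E F : Type*} [Fintype A] [DecidableEq A] [Fintype D] [DecidableEq D]
  [Fintype E] [Fintype F] [DecidableEq F]

omit [DecidableEq A] [DecidableEq F] in
/-- An operator on `ADF` with the same `AF`-marginal as a pure state on `AEF` has its
`AD`-marginal dominated by the image of the `AE`-marginal of that state under a channel. -/
theorem exists_isChannel_of_marginalAF_eq [Nonempty D] {T : Matrix ((A × D) × F) ((A × D) × F) ℂ}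
    (hT : T.PosSemidef) (ψ : (A × E) × F → ℂ)
    (h : marginalAF T = marginalAF (vecMulVec ψ (star ψ))) :
    ∃ Γ : Matrix E E ℂ →ₗ[ℂ] Matrix D D ℂ, IsChannel Γ ∧
      (idTensor Γ (traceRight (vecMulVec ψ (star ψ))) - traceRight T).PosSemidef := by
  classical
  obtain ⟨Z, rfl⟩ := exists_eq_mul_conjTranspose hT
  -- `M` reshapes `ψ` as a map from `AF` to `E`; `M'` reshapes `Z`, a purification of `T`, as a map
  -- from `AF` to `D` and an environment. Their Gram matrices are the complex conjugates of the
  -- `AF`-marginals.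
  set M : Matrix E (A × F) ℂ := of fun e x => ψ ((x.1, e), x.2)
  set M' : Matrix (D × ((A × D) × F)) (A × F) ℂ := of fun y x => Z ((x.1, y.1), x.2) y.2
  have hgram : Mᴴ * M = M'ᴴ * M' := by
    ext x y
    have h1 := congrArg star (congrFun (congrFun h x) y)
    simp only [marginalAF, of_apply, mul_apply, conjTranspose_apply, vecMulVec_apply, star_sum,
      star_mul', star_star, Pi.star_apply] at h1
    simp only [M, M', mul_apply, conjTranspose_apply, of_apply, Fintype.sum_prod_type (α₁ := D)]
    exact h1.symm
  obtain ⟨C, hC, hC1⟩ := exists_contraction_of_conjTranspose_mul_self_eq hgram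
  -- Slicing the contraction along the environment index gives Kraus operators. They may lose trace
  -- off the support of the state, so completing them to a channel yields domination.
  set V : (A × D) × F → Matrix D E ℂ := fun g => of fun d e => C (d, g) e
  have hV : ∑ g, (V g)ᴴ * V g = Cᴴ * C := by
    ext e e'
    simp only [V, Matrix.sum_apply, mul_apply, conjTranspose_apply, of_apply,
      Fintype.sum_prod_type (α₁ := D)]
    exact Finset.sum_comm
  obtain ⟨Γ, Γ', hΓ, hΓ', rfl⟩ := exists_isChannel_sub_isCompletelyPositive V (by rwa [hV])
  refine ⟨_, hΓ, ?_⟩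
  have hσ : traceRight (vecMulVec ψ (star ψ)) =
      ∑ f, vecMulVec (fun x : A × E => ψ (x, f)) (star fun x : A × E => ψ (x, f)) := by
    ext x y
    simp [traceRight, Matrix.sum_apply, vecMulVec_apply]
  have hT' : traceRight (Z * Zᴴ) = idTensor (∑ g, conjMap (V g))
      (traceRight (vecMulVec ψ (star ψ))) := by
    rw [sum_idTensor, hσ]
    simp only [idTensor_sum, idTensor_conjMap_vecMulVec]
    have hZ : ∀ (g : (A × D) × F) (f : F),
        (fun x : A × D => ∑ e, V g x.2 e * ψ ((x.1, e), f)) = fun x => Z (x, f) g := by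
      intro g f
      ext x
      have h1 := congrFun (congrFun hC (x.2, g)) (x.1, f)
      simp only [M, M', mul_apply, of_apply] at h1
      exact h1.symm
    simp only [hZ]
    ext x y
    simp only [traceRight, of_apply, mul_apply, conjTranspose_apply, Matrix.sum_apply,
      vecMulVec_apply, Pi.star_apply]
    exact Finset.sum_comm
  rw [hT', add_idTensor, add_sub_cancel_left]
  refine hΓ'.posSemidef_idTensor (posSemidef_traceRight (posSemidef_vecMulVec_self_star ψ))

omit [DecidableEq A] in
/-- Weak duality: a feasible pair bounds `tr[R Γ(σ)]` for every channel `Γ`. -/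
theorem re_trace_mul_idTensor_le {τ : Matrix ((A × E) × F) ((A × E) × F) ℂ} (hτ : τ.PosSemidef)
    {R : Matrix (A × D) (A × D) ℂ} {S : Matrix (A × F) (A × F) ℂ}
    (hRS : (oneTensorAF S - R ⊗ₖ (1 : Matrix F F ℂ)).PosSemidef)
    {Γ : Matrix E E ℂ →ₗ[ℂ] Matrix D D ℂ} (hΓ : IsChannel Γ) :
    (R * idTensor Γ (traceRight τ)).trace.re ≤ (S * marginalAF τ).trace.re := by
  -- This is `Γ` applied to the `E` factor of `τ`, with `E` moved to the last position and `D` moved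
  -- back. Its `AD`-marginal is the recovered state; trace preservation fixes its `AF`-marginal.
  set T : Matrix ((A × D) × F) ((A × D) × F) ℂ :=
    (idTensor Γ (τ.submatrix (fun x : (A × F) × E => ((x.1.1, x.2), x.1.2))
      fun x : (A × F) × E => ((x.1.1, x.2), x.1.2))).submatrix
      (fun x => ((x.1.1, x.2), x.1.2)) fun x => ((x.1.1, x.2), x.1.2)
  have hT : T.PosSemidef :=
    (IsCompletelyPositive.posSemidef_idTensor hΓ.completelyPositive (hτ.submatrix _)).submatrix _
  have h1 : traceRight T = idTensor Γ (traceRight τ) := by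
    ext x y
    have : (of fun e e' => traceRight τ (x.1, e) (y.1, e')) =
        ∑ f, of fun e e' => τ ((x.1, e), f) ((y.1, e'), f) := by
      ext e e'
      simp [traceRight, Matrix.sum_apply]
    simp only [idTensor, of_apply, this, map_sum, Matrix.sum_apply]
    rfl
  have h2 : marginalAF T = marginalAF τ := by
    ext x y
    exact hΓ.tracePreserving (of fun e e' => τ ((x.1, e), x.2) ((y.1, e'), y.2))
  have h3 := re_trace_mul_nonneg hRS hT
  rw [sub_mul, trace_sub, Complex.sub_re, trace_oneTensorAF_mul, trace_kronecker_one_mul, h1,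
    h2] at h3
  linarith

end Recovery

/-! ### Lower bound on the measured relative entropy -/

section Measured
variable {K : Type*} [Fintype K] [DecidableEq K]

theorem klDivergence_le_measuredRelEntropy {X : Type*} [Fintype X] {M : X → Matrix K K ℂ}
    (hM : IsPOVM M) (ρ σ : Matrix K K ℂ) :
    klDivergence (outcome M ρ) (outcome M σ) ≤ measuredRelEntropy ρ σ := by
  set e := Fintype.equivFin X
  have hM' : IsPOVM fun i => M (e.symm i) :=
    ⟨fun i => hM.1 _, by rw [Equiv.sum_comp e.symm M]; exact hM.2⟩
  have h1 : klDivergence (outcome M ρ) (outcome M σ) =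
      klDivergence (outcome (fun i => M (e.symm i)) ρ) (outcome (fun i => M (e.symm i)) σ) := by
    have h2 : (∑ i, outcome (fun i => M (e.symm i)) ρ i *
        Real.log (outcome (fun i => M (e.symm i)) ρ i / outcome (fun i => M (e.symm i)) σ i))
        = ∑ x, outcome M ρ x * Real.log (outcome M ρ x / outcome M σ x) :=
      Equiv.sum_comp e.symm fun x => outcome M ρ x * Real.log (outcome M ρ x / outcome M σ x)
    have h3 : (∀ i, outcome (fun i => M (e.symm i)) σ i = 0 →
        outcome (fun i => M (e.symm i)) ρ i = 0) ↔ ∀ x, outcome M σ x = 0 → outcome M ρ x = 0 :=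
      e.symm.forall_congr_left.trans (by simp [outcome])
    simp only [klDivergence, h3, h2]
  rw [h1]
  exact le_iSup_of_le _ (le_iSup_of_le _ (le_iSup_of_le hM' le_rfl))

/-- `D^𝕄(ρ‖R) ≥ tr[ρ log τ]` whenever `tr[R τ] ≤ 1` and `ρ ≪ τ`. -/
theorem logTrace_le_measuredRelEntropy {ρ R τ : Matrix K K ℂ} (hρ : IsDensity ρ) (hR : R.PosDef)
    (hτ : τ.PosSemidef) (hker : ∀ v : K → ℂ, τ *ᵥ v = 0 → ρ *ᵥ v = 0)
    (hle : (R * τ).trace.re ≤ 1) : ((logTrace ρ τ : ℝ) : EReal) ≤ measuredRelEntropy ρ R := by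
  obtain ⟨l, P, hP⟩ := exists_isResolution hτ.1
  have hr : ∀ i, 0 < outcome P R i := fun i => outcome_pos hP.povm hR fun h0 => by
    simpa [h0] using hP.trace_eq i
  have hp := outcome_nonneg hP.povm hρ.1
  have hl := hP.eigenvalue_nonneg hτ
  -- The support condition makes the convention `log 0 = 0` harmless: a zero eigenvalue of `τ`
  -- carries no weight of `ρ`.
  have hzero : ∀ i, l i = 0 → outcome P ρ i = 0 := by
    intro i hi
    have h1 : ρ * P i = 0 := by
      ext a b
      have h2 := hker ((P i).col b) (by
        have := hP.mul_proj i
        rw [hi] at this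
        ext c
        have := congrFun (congrFun this c) b
        simpa [mul_apply, mulVec, dotProduct] using this)
      simpa [mul_apply, mulVec, dotProduct] using congrFun h2 a
    rw [outcome, trace_mul_comm, h1]
    simp
  refine le_trans ?_ (klDivergence_le_measuredRelEntropy hP.povm ρ R)
  rw [klDivergence, if_pos fun i hi => absurd hi (hr i).ne', EReal.coe_le_coe_iff, logTrace,
    matLog, hP.re_trace_mul_cfc]
  -- This is `log x ≤ x - 1` at `x = l r / p`, multiplied by `p`. Summed over `i`, the right side is
  -- `tr[R τ] - 1 ≤ 0`.
  have hterm : ∀ i, Real.log (l i) * outcome P ρ i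
      - outcome P ρ i * Real.log (outcome P ρ i / outcome P R i)
      ≤ l i * outcome P R i - outcome P ρ i := by
    intro i
    rcases (hp i).eq_or_lt with h0 | h0
    · rw [← h0]
      have := mul_nonneg (hl i) (hr i).le
      simpa using this
    · have hli : 0 < l i := (hl i).lt_of_ne fun h => h0.ne' (hzero i h.symm)
      have h1 : Real.log (l i) - Real.log (outcome P ρ i / outcome P R i)
          = Real.log (l i * outcome P R i / outcome P ρ i) := by
        rw [Real.log_div h0.ne' (hr i).ne', Real.log_div (mul_pos hli (hr i)).ne' h0.ne',
          Real.log_mul hli.ne' (hr i).ne']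
        ring
      have h2 := Real.log_le_sub_one_of_pos (div_pos (mul_pos hli (hr i)) h0)
      rw [← h1] at h2
      have h3 := mul_le_mul_of_nonneg_left h2 h0.le
      have h4 : outcome P ρ i * (l i * outcome P R i / outcome P ρ i - 1)
          = l i * outcome P R i - outcome P ρ i := by
        rw [mul_sub, mul_div_cancel₀ _ h0.ne', mul_one]
      linarith
  have hs := Finset.sum_le_sum fun i (_ : i ∈ Finset.univ) => hterm i
  have h5 : ∑ i, l i * outcome P R i = (R * τ).trace.re := by
    rw [← re_trace_mul_sum_smul, ← hP.eq_sum]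
  rw [Finset.sum_sub_distrib, Finset.sum_sub_distrib, h5, sum_outcome hP.povm, hρ.2] at hs
  simp only [Complex.one_re] at hs
  linarith

end Measured

/-! ### Near-optimal feasible pairs and the main theorem -/

section Main
variable {A D E F : Type*} [Fintype A] [DecidableEq A] [Fintype D] [DecidableEq D]
  [Fintype E] [Fintype F] [DecidableEq F]

theorem relEntropy_eq_of_ker {K : Type*} [Fintype K] [DecidableEq K] {ρ σ : Matrix K K ℂ}
    (h : ∀ v : K → ℂ, σ *ᵥ v = 0 → ρ *ᵥ v = 0) :
    relEntropy ρ σ = (((ρ * matLog ρ).trace.re - logTrace ρ σ : ℝ) : EReal) := by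
  rw [relEntropy, if_pos h, mul_sub, trace_sub, Complex.sub_re, logTrace]

theorem ker_of_posDef {K : Type*} [Fintype K] {ρ σ : Matrix K K ℂ} (hσ : σ.PosDef)
    (v : K → ℂ) (hv : σ *ᵥ v = 0) : ρ *ᵥ v = 0 := by
  by_cases h0 : v = 0
  · simp [h0]
  · have := hσ.re_dotProduct_pos h0
    simp [hv] at this

omit [Fintype A] [DecidableEq A] [DecidableEq D] in
theorem convex_setOf_recovered (σ : Matrix (A × E) (A × E) ℂ) :
    Convex ℝ {X : Matrix (A × D) (A × D) ℂ | ∃ Γ, IsChannel Γ ∧ X = idTensor Γ σ} := by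
  rintro _ ⟨Γ, hΓ, rfl⟩ _ ⟨Γ', hΓ', rfl⟩ s t hs ht hst
  refine ⟨_, hΓ.combination hΓ' hs ht hst, ?_⟩
  rw [add_idTensor, smul_idTensor, smul_idTensor]
  rfl

omit [DecidableEq A] [DecidableEq D] in
theorem trace_idTensor {Γ : Matrix E E ℂ →ₗ[ℂ] Matrix D D ℂ} (hΓ : IsChannel Γ)
    (σ : Matrix (A × E) (A × E) ℂ) : (idTensor Γ σ).trace = σ.trace := by
  simp only [trace, diag_apply, Fintype.sum_prod_type]
  exact Finset.sum_congr rfl fun a _ =>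
    hΓ.tracePreserving (of fun e e' => σ (a, e) (a, e'))

/-- A lower bound for the relative entropy of recovery is attained by the dual program up to `ε`. -/
theorem exists_feasible_of_le_relEntropy {ρ : Matrix (A × D) (A × D) ℂ} (hρ : IsDensity ρ)
    {ψ : (A × E) × F → ℂ} {σ : Matrix (A × E) (A × E) ℂ} (hσ : IsDensity σ)
    (hψ : traceRight (vecMulVec ψ (star ψ)) = σ) (hσA : (traceRight σ).PosDef) {d : ℝ}
    (hd : ∀ Γ : Matrix E E ℂ →ₗ[ℂ] Matrix D D ℂ, IsChannel Γ →
      (d : EReal) ≤ relEntropy ρ (idTensor Γ σ)) {ε : ℝ} (hε : 0 < ε) :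
    ∃ (R : Matrix (A × D) (A × D) ℂ) (S : Matrix (A × F) (A × F) ℂ), R.PosDef ∧ S.PosDef ∧
      (oneTensorAF S - R ⊗ₖ (1 : Matrix F F ℂ)).PosSemidef ∧
      (S * marginalAF (vecMulVec ψ (star ψ))).trace = 1 ∧
      measuredRelEntropy ρ R ≤ (((ρ * matLog ρ).trace.re - d + ε : ℝ) : EReal) := by
  have hne : Nonempty (A × D) := by
    by_contra hempty
    rw [not_nonempty_iff] at hempty
    simpa [trace] using hρ.2
  have hD : Nonempty D := hne.map Prod.snd
  set m : ℝ := (ρ * matLog ρ).trace.re - d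
  set τ := vecMulVec ψ (star ψ)
  have hτ : τ.PosSemidef := posSemidef_vecMulVec_self_star ψ
  set κ := marginalAF τ
  have hκ : IsDensity κ := by
    refine ⟨posSemidef_marginalAF hτ, ?_⟩
    rw [trace_marginalAF, ← hσ.2, ← hψ]
    simp [trace, traceRight, Fintype.sum_prod_type (α₁ := A × E)]
  have hpsd : ∀ Γ : Matrix E E ℂ →ₗ[ℂ] Matrix D D ℂ, IsChannel Γ → (idTensor Γ σ).PosSemidef :=
    fun Γ hΓ => IsCompletelyPositive.posSemidef_idTensor hΓ.completelyPositive hσ.1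
  obtain ⟨R₀, c, hR₀, hupper, hC⟩ := exists_supergradient hρ (m := m)
    (convex_setOf_recovered (D := D) σ)
    (by rintro _ ⟨Γ, hΓ, rfl⟩; exact (hpsd Γ hΓ).1)
    ⟨replacement D E, isChannel_replacement, rfl⟩ (posDef_idTensor_replacement hσA)
    (by
      rintro _ ⟨Γ, hΓ, rfl⟩ hpos
      have h1 := hd Γ hΓ
      rw [relEntropy_eq_of_ker (ker_of_posDef hpos), EReal.coe_le_coe_iff] at h1
      simp only [m]
      linarith)
  -- One `δ` pays for making `R₀` positive definite, as `δ • 1` adds `δ` on states; the other is the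
  -- slack in the dual program.
  set δ : ℝ := ε / 2
  have hδ : 0 < δ := half_pos hε
  set R₁ : Matrix (A × D) (A × D) ℂ := R₀ + (δ : ℂ) • 1
  have hR₁ : R₁.PosDef := PosDef.posSemidef_add hR₀ (PosDef.one.smul (by exact_mod_cast hδ))
  have htr : ∀ X, (R₁ * X).trace.re = (R₀ * X).trace.re + δ * X.trace.re := fun X => by
    rw [add_mul, trace_add, Complex.add_re, smul_mul_assoc, one_mul, re_trace_real_smul]
  obtain ⟨S, -, hS, hSκ⟩ := exists_dual_feasible hR₁.isHermitian hκ (k := m - c + δ)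
    (fun T hT hTκ => by
      obtain ⟨Γ, hΓ, hle⟩ := exists_isChannel_of_marginalAF_eq hT ψ hTκ
      rw [hψ] at hle
      have h1 := re_trace_mul_nonneg hR₁.posSemidef hle
      rw [mul_sub, trace_sub, Complex.sub_re, htr, trace_idTensor hΓ, hσ.2, Complex.one_re] at h1
      have h2 := hC _ ⟨Γ, hΓ, rfl⟩
      rw [trace_kronecker_one_mul]
      linarith) hδ
  have hSpos : S.PosDef := by
    obtain ⟨d₀⟩ := hD
    -- `1 ⊗ S ≥ R₁ ⊗ 1 > 0`, and `S` is the diagonal block of `1 ⊗ S` at a fixed index of `D`.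
    have h1 : (oneTensorAF (D := D) S).PosDef := by
      simpa using PosDef.posSemidef_add hS (hR₁.kronecker (PosDef.one (n := F)))
    have h2 := h1.submatrix (e := fun x : A × F => ((x.1, d₀), x.2)) (by
      rintro ⟨a, f⟩ ⟨a', f'⟩ h
      simpa using h)
    convert h2 using 1
    ext x y
    simp [oneTensorAF]
  set k : ℝ := (S * κ).trace.re
  have hk : 0 < k := by
    have hκ0 : κ ≠ 0 := fun h0 => by simpa [h0] using hκ.2
    simp only [k]
    rw [trace_mul_comm]
    exact re_trace_mul_pos hκ.1 hκ0 hSpos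
  have hkc : (S * κ).trace = (k : ℂ) := by
    apply Complex.ext
    · simp [k]
    · simpa using (Complex.le_def.1 (trace_mul_nonneg hSpos.posSemidef hκ.1)).2.symm
  have hkinv : (0 : ℂ) < ((k⁻¹ : ℝ) : ℂ) := by exact_mod_cast inv_pos.2 hk
  refine ⟨((k⁻¹ : ℝ) : ℂ) • R₁, ((k⁻¹ : ℝ) : ℂ) • S, hR₁.smul hkinv, hSpos.smul hkinv, ?_, ?_, ?_⟩
  · convert hS.smul hkinv.le using 1
    ext x y
    simp [oneTensorAF]
    ring
  · rw [smul_mul_assoc, trace_smul, hkc, smul_eq_mul, ← Complex.ofReal_mul, inv_mul_cancel₀ hk.ne',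
      Complex.ofReal_one]
  -- Undoing the normalization by `k` costs `log k ≤ k - 1`, so the bound `c + 1 + log k` is at most
  -- `c + k ≤ m + ε`.
  · refine (measuredRelEntropy_le hρ (hR₁.smul hkinv) hk (c := c) fun ω hω => ?_).trans ?_
    · rw [smul_mul_assoc, re_trace_real_smul, mul_inv_cancel_left₀ hk.ne', htr]
      have h1 := hupper ω hω
      have h2 := mul_nonneg hδ.le (Complex.le_def.1 hω.posSemidef.trace_nonneg).1
      linarith
    · rw [EReal.coe_le_coe_iff]
      have h1 := Real.log_le_sub_one_of_pos hk
      have h2 : δ + δ = ε := add_halves ε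
      linarith

end Main

end

end RelEntRecovery

theorem lemma5 {A D E F : Type*}
    [Fintype A] [DecidableEq A] [Fintype D] [DecidableEq D]
    [Fintype E] [Fintype F] [DecidableEq F]
    (ρ : Matrix (A × D) (A × D) ℂ) (σ : Matrix (A × E) (A × E) ℂ)
    (τ : Matrix ((A × E) × F) ((A × E) × F) ℂ)
    (hρ : RelEntRecovery.IsDensity ρ) (hσ : RelEntRecovery.IsDensity σ)
    (hσA : (RelEntRecovery.traceRight σ).PosDef)
    (hτ : RelEntRecovery.IsPurification τ σ) :
    RelEntRecovery.relEntropyOfRecovery ρ σ =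
      sSup {v : EReal | ∃ (R : Matrix (A × D) (A × D) ℂ) (S : Matrix (A × F) (A × F) ℂ),
        R.PosDef ∧ S.PosDef ∧
        (RelEntRecovery.oneTensorAF S - R ⊗ₖ (1 : Matrix F F ℂ)).PosSemidef ∧
        (S * RelEntRecovery.marginalAF τ).trace = 1 ∧
        v = (((ρ * RelEntRecovery.matLog ρ).trace.re : ℝ) : EReal)
          - RelEntRecovery.measuredRelEntropy ρ R} := by
  obtain ⟨⟨ψ, rfl⟩, hψ⟩ := hτ
  apply le_antisymm
  · rcases eq_or_ne (RelEntRecovery.relEntropyOfRecovery ρ σ) ⊥ with hbot | hbot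
    · rw [hbot]
      exact bot_le
    have hle : ∀ Γ : Matrix E E ℂ →ₗ[ℂ] Matrix D D ℂ, RelEntRecovery.IsChannel Γ →
        RelEntRecovery.relEntropyOfRecovery ρ σ
          ≤ RelEntRecovery.relEntropy ρ (RelEntRecovery.idTensor Γ σ) :=
      fun Γ hΓ => iInf_le_of_le Γ (iInf_le_of_le hΓ le_rfl)
    -- Since `σ_A > 0`, the replacement channel outputs a positive definite state, at finite
    -- relative entropy from `ρ`.
    have htop : RelEntRecovery.relEntropyOfRecovery ρ σ ≠ ⊤ := by
      have hne : Nonempty (A × D) := by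
        by_contra hempty
        rw [not_nonempty_iff] at hempty
        simpa [Matrix.trace] using hρ.2
      have hD : Nonempty D := hne.map Prod.snd
      refine ne_top_of_le_ne_top ?_ (hle _ RelEntRecovery.isChannel_replacement)
      rw [RelEntRecovery.relEntropy_eq_of_ker
        (RelEntRecovery.ker_of_posDef (RelEntRecovery.posDef_idTensor_replacement hσA))]
      exact EReal.coe_ne_top _
    lift RelEntRecovery.relEntropyOfRecovery ρ σ to ℝ using ⟨htop, hbot⟩ with d
    -- The supremum need only be approached: for real `x < d`, a feasible pair with error `d - x`
    -- has value at least `x`.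
    refine le_of_forall_lt fun b hb => ?_
    obtain ⟨x, hbx, hxd⟩ := EReal.lt_iff_exists_real_btwn.1 hb
    rw [EReal.coe_lt_coe_iff] at hxd
    obtain ⟨R, S, hR, hS, hRS, htr, hM⟩ := RelEntRecovery.exists_feasible_of_le_relEntropy hρ hσ hψ
      hσA hle (sub_pos.2 hxd)
    refine hbx.trans_le (le_trans ?_ (le_sSup ⟨R, S, hR, hS, hRS, htr, rfl⟩))
    refine le_trans (le_of_eq ?_) (EReal.sub_le_sub le_rfl hM)
    rw [← EReal.coe_sub]
    congr 1
    ring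
  · refine sSup_le ?_
    rintro _ ⟨R, S, hR, hS, hRS, htr, rfl⟩
    refine le_iInf fun Γ => le_iInf fun hΓ => ?_
    by_cases hker : ∀ v : A × D → ℂ, RelEntRecovery.idTensor Γ σ *ᵥ v = 0 → ρ *ᵥ v = 0
    · rw [RelEntRecovery.relEntropy_eq_of_ker hker, EReal.coe_sub]
      refine EReal.sub_le_sub le_rfl (RelEntRecovery.logTrace_le_measuredRelEntropy hρ hR
        (RelEntRecovery.IsCompletelyPositive.posSemidef_idTensor hΓ.completelyPositive hσ.1) hker ?_)
      have h1 := RelEntRecovery.re_trace_mul_idTensor_le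
        (Matrix.posSemidef_vecMulVec_self_star ψ) hRS hΓ
      rw [hψ, htr] at h1
      simpa using h1
    · rw [RelEntRecovery.relEntropy, if_neg hker]
      exact le_top
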